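/- Let $(M^n,g)$ be a compact Hermitian manifold of complex dimension $n$ and let $R$ be the curvature tensor of its Chern connection, which in local holomorphic coordinates is $$R_{i\bar j k\bar l}=-\frac{\partial^2 g_{k\bar l}}{\partial z^i\partial\bar z^j}+g^{p\bar q}\frac{\partial g_{k\bar q}}{\partial z^i}\frac{\partial g_{p\bar l}}{\partial\bar z^j}.$$ Let $$\mathrm{Ric}^{(1)}_{i\bar j}=g^{k\bar l}R_{i\bar jk\bar l},\quad \mathrm{Ric}^{(2)}_{k\bar l}=g^{i\bar j}R_{i\bar jk\bar l},\quad \mathrm{Ric}^{(3)}_{i\bar l}=g^{k\bar j}R_{i\bar jk\bar l},\quad \mathrm{Ric}^{(4)}_{k\bar j}=g^{i\bar l}R_{i\bar jk\bar l}$$ be the four Chern Ricci curvatures, $u=g^{i\bar j}\mathrm{Ric}^{(1)}_{i\bar j}$ the Chern scalar curvature and $v=g^{i\bar l}\mathrm{Ric}^{(3)}_{i\bar l}$ the altered Chern scalar curvature. Let $T_{ij}^k=g^{k\bar l}(\partial_i g_{j\bar l}-\partial_j g_{i\bar l})$ be the Chern torsion, $\eta=\sum_{i,k}T_{ik}^k\,dz^i$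 the torsion $(1,0)$-form and $\omega=\sqrt{-1}\sum_{i,j} g_{i\bar j}\,dz^i\wedge d\bar z^j$ the Kähler form. For $k\in\{1,2,3,4\}$, $\alpha,\beta\in\mathbb R$ with $\beta\neq 0$, and $0\neq X\in T^{1,0}M$ put $$\mathcal C^{(k)}_{\alpha,\beta}(X)=\frac{\alpha}{|X|_g^2}\,\mathrm{Ric}^{(k)}(X,\bar X)+\beta\,\frac{R(X,\bar X,X,\bar X)}{|X|_g^4}.$$ Theorem 1.3. If, for some $k\in\{1,2,3,4\}$, $\mathcal C^{(k)}_{\alpha,\beta}(X)=0$ for all nonzero $(1,0)$-tangent vectors $X$, and $\alpha(n+1)+2\beta=0$, then $u=v$ at every point of $M$, the torsion form $\eta$ vanishes identically, and $g$ is balanced, that is, $d(\omega^{n-1})=0$. -/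

import Mathlib

open scoped Manifold ContDiff ComplexConjugate Matrix

noncomputable section

/-- The model space `ℂⁿ` of complex manifolds of complex dimension `n`. -/
abbrev CSpace (n : ℕ) : Type := EuclideanSpace ℂ (Fin n)

/-! ### Calculus on open subsets of `ℂⁿ` -/

section Calculus

variable {n : ℕ}

/-- The `i`-th standard basis vector of `ℂⁿ`. -/
def stdVec (i : Fin n) : CSpace n := EuclideanSpace.single i 1

/-- The Wirtinger derivative `∂f/∂zⁱ = (∂f/∂xⁱ - √-1 ∂f/∂yⁱ) / 2`. -/
def dZ (i : Fin n) (f : CSpace n → ℂ) (z : CSpace n) : ℂ :=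
  (fderiv ℝ f z (stdVec i) - Complex.I * fderiv ℝ f z (Complex.I • stdVec i)) / 2

/-- The Wirtinger derivative `∂f/∂z̄ⁱ = (∂f/∂xⁱ + √-1 ∂f/∂yⁱ) / 2`. -/
def dZbar (i : Fin n) (f : CSpace n → ℂ) (z : CSpace n) : ℂ :=
  (fderiv ℝ f z (stdVec i) + Complex.I * fderiv ℝ f z (Complex.I • stdVec i)) / 2

/-- The constant 1-form `dzⁱ` on `ℂⁿ`. -/
def formDz (i : Fin n) : CSpace n →L[ℝ] ℂ :=
  (EuclideanSpace.proj i : CSpace n →L[ℂ] ℂ).restrictScalars ℝ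

/-- The constant 1-form `dz̄ⁱ` on `ℂⁿ`. -/
def formDzbar (i : Fin n) : CSpace n →L[ℝ] ℂ :=
  (Complex.conjCLE : ℂ →L[ℝ] ℂ).comp (formDz i)

/-- The wedge product of two complex valued 1-forms:
`(a ∧ b) (v, w) = a v * b w - a w * b v`. -/
def wedgeOne (a b : CSpace n →L[ℝ] ℂ) : CSpace n [⋀^Fin 2]→L[ℝ] ℂ :=
  ContinuousMultilinearMap.alternatization
    ((ContinuousMultilinearMap.mkPiAlgebra ℝ (Fin 2) ℂ).compContinuousLinearMap ![a, b])

/-- The multilinear map `(v₀, …, v_{2m-1}) ↦ ∏ₐ θ (v_{2a}, v_{2a+1})`. -/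
def pairProd (θ : CSpace n [⋀^Fin 2]→L[ℝ] ℂ) (m : ℕ) :
    ContinuousMultilinearMap ℝ (fun _ : Fin (m * 2) => CSpace n) ℂ where
  toFun v := ∏ a : Fin m, θ (fun b => v (finProdFinEquiv (a, b)))
  map_update_add' := by
    intro _ v i x y
    obtain ⟨⟨a, b⟩, rfl⟩ := finProdFinEquiv.surjective i
    have h1 : ∀ t : CSpace n, (fun b' => Function.update v (finProdFinEquiv (a, b)) t
        (finProdFinEquiv (a, b'))) =
        Function.update (fun b' => v (finProdFinEquiv (a, b'))) b t := by
      intro t; funext b'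
      by_cases h : b' = b
      · subst h; simp
      · simp [h]
    have h2 : ∀ t : CSpace n, ∀ a' ∈ Finset.univ.erase a,
        θ (fun b' => Function.update v (finProdFinEquiv (a, b)) t (finProdFinEquiv (a', b'))) =
        θ (fun b' => v (finProdFinEquiv (a', b'))) := by
      intro t a' ha'
      have : a' ≠ a := Finset.ne_of_mem_erase ha'
      simp [this]
    simp only [← Finset.mul_prod_erase Finset.univ _ (Finset.mem_univ a)]
    rw [Finset.prod_congr rfl (h2 _), Finset.prod_congr rfl (h2 _), Finset.prod_congr rfl (h2 _),
      h1, h1, h1, θ.map_update_add, add_mul]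
  map_update_smul' := by
    intro _ v i c x
    obtain ⟨⟨a, b⟩, rfl⟩ := finProdFinEquiv.surjective i
    have h1 : ∀ t : CSpace n, (fun b' => Function.update v (finProdFinEquiv (a, b)) t
        (finProdFinEquiv (a, b'))) =
        Function.update (fun b' => v (finProdFinEquiv (a, b'))) b t := by
      intro t; funext b'
      by_cases h : b' = b
      · subst h; simp
      · simp [h]
    have h2 : ∀ t : CSpace n, ∀ a' ∈ Finset.univ.erase a,
        θ (fun b' => Function.update v (finProdFinEquiv (a, b)) t (finProdFinEquiv (a', b'))) =
        θ (fun b' => v (finProdFinEquiv (a', b'))) := by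
      intro t a' ha'
      have : a' ≠ a := Finset.ne_of_mem_erase ha'
      simp [this]
    simp only [← Finset.mul_prod_erase Finset.univ _ (Finset.mem_univ a)]
    rw [Finset.prod_congr rfl (h2 _), Finset.prod_congr rfl (h2 _),
      h1, h1, θ.map_update_smul, smul_mul_assoc]
  cont := by
    refine continuous_finsetProd _ fun a _ => θ.cont.comp ?_
    exact continuous_pi fun b => continuous_apply _

/-- The `m`-th exterior power `θ ∧ ⋯ ∧ θ` of a 2-form:
`θᵐ (v₀, …, v_{2m-1}) = 2⁻ᵐ ∑_σ sgn σ ∏ₐ θ (v_{σ(2a)}, v_{σ(2a+1)})`. -/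
def formPow (θ : CSpace n [⋀^Fin 2]→L[ℝ] ℂ) (m : ℕ) : CSpace n [⋀^Fin (m * 2)]→L[ℝ] ℂ :=
  ((1 / 2 : ℝ) ^ m) • ContinuousMultilinearMap.alternatization (pairProd θ m)

end Calculus

/-! ### Holomorphic coordinates and Hermitian metrics -/

section Manifold

variable {n : ℕ} {M : Type*} [TopologicalSpace M] [ChartedSpace (CSpace n) M]

/-- The coordinate vector `∂/∂zⁱ` of the chart `e` at the point with coordinates `z`. The complex
tangent space `T_pM` is identified with `T^{1,0}_pM`. -/
def coordVec (e : OpenPartialHomeomorph M (CSpace n)) (z : CSpace n) (i : Fin n) :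
    TangentSpace 𝓘(ℂ, CSpace n) (e.symm z) :=
  mfderiv 𝓘(ℂ, CSpace n) 𝓘(ℂ, CSpace n) e.symm z (stdVec i)

/-- The differential `dzⁱ : T_pM → ℂ` of the `i`-th coordinate of the chart `e`; thus
`X = ∑ᵢ dzⁱ(X) ∂/∂zⁱ`. -/
def coordForm (e : OpenPartialHomeomorph M (CSpace n)) (p : M) (i : Fin n) :
    TangentSpace 𝓘(ℂ, CSpace n) p →L[ℂ] ℂ :=
  (EuclideanSpace.proj i : CSpace n →L[ℂ] ℂ).comp
    (mfderiv 𝓘(ℂ, CSpace n) 𝓘(ℂ, CSpace n) e p)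

end Manifold

/-- A smooth Hermitian metric on a complex manifold: a positive definite Hermitian form on every
holomorphic tangent space (complex linear in the first variable, conjugate linear in the second)
whose coefficients `g_{i j̄}` are `C^∞` (in the real sense) in every holomorphic chart. -/
structure HermitianMetric (n : ℕ) (M : Type*) [TopologicalSpace M] [ChartedSpace (CSpace n) M] where
  form : ∀ p : M, TangentSpace 𝓘(ℂ, CSpace n) p →ₗ[ℂ] TangentSpace 𝓘(ℂ, CSpace n) p →ₗ⋆[ℂ] ℂ
  conj_symm : ∀ (p : M) (X Y : TangentSpace 𝓘(ℂ, CSpace n) p),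
    conj (form p X Y) = form p Y X
  pos_def : ∀ (p : M) (X : TangentSpace 𝓘(ℂ, CSpace n) p), X ≠ 0 → 0 < (form p X X).re
  smooth : ∀ e ∈ IsManifold.maximalAtlas 𝓘(ℂ, CSpace n) ω M, ∀ i j : Fin n,
    ContDiffOn ℝ ∞
      (fun z : CSpace n => form (e.symm z) (coordVec e z i) (coordVec e z j)) e.target

/-- The labels of the four Chern Ricci curvatures. -/
inductive RicciKind where
  | first
  | second
  | third
  | fourth

namespace HermitianMetric

variable {n : ℕ} {M : Type*} [TopologicalSpace M] [ChartedSpace (CSpace n) M]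
  (g : HermitianMetric n M)

/-! ### Quantities in a holomorphic chart -/

section Local

variable (e : OpenPartialHomeomorph M (CSpace n)) (z : CSpace n)

/-- `g_{i j̄} = g(∂/∂zⁱ, ∂/∂zʲ)`. -/
def coeff (i j : Fin n) (z : CSpace n) : ℂ :=
  g.form (e.symm z) (coordVec e z i) (coordVec e z j)

/-- The inverse coefficients `g^{i j̄}`, normalized by `∑_q g^{p q̄} g_{k q̄} = δ_{pk}`. -/
def invCoeff (i j : Fin n) : ℂ :=
  ((Matrix.of fun a b => g.coeff e a b z)ᵀ)⁻¹ i j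

/-- The curvature of the Chern connection:
`R_{i j̄ k l̄} = - ∂ᵢ∂_{j̄} g_{k l̄} + g^{p q̄} ∂ᵢ g_{k q̄} ∂_{j̄} g_{p l̄}`. -/
def chernCurv (i j k l : Fin n) : ℂ :=
  - dZ i (dZbar j (g.coeff e k l)) z
    + ∑ p, ∑ q, g.invCoeff e z p q * dZ i (g.coeff e k q) z * dZbar j (g.coeff e p l) z

/-- The coefficients of the four Chern Ricci curvatures:
`Ric⁽¹⁾_{a b̄} = g^{k l̄} R_{a b̄ k l̄}`, `Ric⁽²⁾_{a b̄} = g^{i j̄} R_{i j̄ a b̄}`,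
`Ric⁽³⁾_{a b̄} = g^{k j̄} R_{a j̄ k b̄}`, `Ric⁽⁴⁾_{a b̄} = g^{i l̄} R_{i b̄ a l̄}`. -/
def chernRicci : RicciKind → Fin n → Fin n → ℂ
  | .first, a, b => ∑ k, ∑ l, g.invCoeff e z k l * g.chernCurv e z a b k l
  | .second, a, b => ∑ i, ∑ j, g.invCoeff e z i j * g.chernCurv e z i j a b
  | .third, a, b => ∑ k, ∑ j, g.invCoeff e z k j * g.chernCurv e z a j k b
  | .fourth, a, b => ∑ i, ∑ l, g.invCoeff e z i l * g.chernCurv e z i b a l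

/-- The Chern torsion `T_{ij}^k = g^{k l̄} (∂ᵢ g_{j l̄} - ∂ⱼ g_{i l̄})`. -/
def torsion (i j k : Fin n) : ℂ :=
  ∑ l, g.invCoeff e z k l * (dZ i (g.coeff e j l) z - dZ j (g.coeff e i l) z)

/-- The Kähler form `ω = √-1 ∑ g_{i j̄} dzⁱ ∧ dz̄ʲ` in the chart `e`. -/
def kahlerForm (z : CSpace n) : CSpace n [⋀^Fin 2]→L[ℝ] ℂ :=
  Complex.I • ∑ i, ∑ j, g.coeff e i j z • wedgeOne (formDz i) (formDzbar j)

end Local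

/-! ### Quantities on the manifold

The tensors below are evaluated at `p` in the preferred holomorphic chart around `p`; by tensoriality
any other holomorphic chart around `p` gives the same values. -/

/-- `|X|²_g = g(X, X̄)`. -/
def normSq (p : M) (X : TangentSpace 𝓘(ℂ, CSpace n) p) : ℝ := (g.form p X X).re

/-- `R(X, X̄, X, X̄)`. -/
def curvDiag (p : M) (X : TangentSpace 𝓘(ℂ, CSpace n) p) : ℂ :=
  let e := chartAt (CSpace n) p
  ∑ i, ∑ j, ∑ k, ∑ l, g.chernCurv e (e p) i j k l *
    (coordForm e p i X * conj (coordForm e p j X) * coordForm e p k X * conj (coordForm e p l X))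

/-- The holomorphic sectional curvature `H(X) = R(X, X̄, X, X̄) / |X|⁴`. -/
def holSectCurv (p : M) (X : TangentSpace 𝓘(ℂ, CSpace n) p) : ℂ :=
  g.curvDiag p X / ((g.normSq p X : ℂ) ^ 2)

/-- `Ric⁽ᵏ⁾(X, X̄)`. -/
def ricciDiag (k : RicciKind) (p : M) (X : TangentSpace 𝓘(ℂ, CSpace n) p) : ℂ :=
  let e := chartAt (CSpace n) p
  ∑ a, ∑ b, g.chernRicci e (e p) k a b * (coordForm e p a X * conj (coordForm e p b X))

/-- The `k`-th mixed curvature `C⁽ᵏ⁾_{α,β}(X) = α / |X|² Ric⁽ᵏ⁾(X, X̄) + β H(X)`. -/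
def mixedCurv (k : RicciKind) (α β : ℝ) (p : M) (X : TangentSpace 𝓘(ℂ, CSpace n) p) : ℂ :=
  (α : ℂ) / (g.normSq p X : ℂ) * g.ricciDiag k p X + (β : ℂ) * g.holSectCurv p X

/-- The Chern scalar curvature `u = g^{i j̄} Ric⁽¹⁾_{i j̄}`. -/
def chernScalar (p : M) : ℂ :=
  let e := chartAt (CSpace n) p
  ∑ i, ∑ j, g.invCoeff e (e p) i j * g.chernRicci e (e p) .first i j

/-- The altered Chern scalar curvature `v = g^{i l̄} Ric⁽³⁾_{i l̄}`. -/
def alteredChernScalar (p : M) : ℂ :=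
  let e := chartAt (CSpace n) p
  ∑ i, ∑ l, g.invCoeff e (e p) i l * g.chernRicci e (e p) .third i l

/-- The torsion `(1,0)`-form `η = ∑ᵢ ηᵢ dzⁱ`, `ηᵢ = ∑ₖ T_{ik}^k`. -/
def torsionForm (p : M) : TangentSpace 𝓘(ℂ, CSpace n) p →L[ℂ] ℂ :=
  let e := chartAt (CSpace n) p
  ∑ i, (∑ k, g.torsion e (e p) i k k) • coordForm e p i

/-- The metric is balanced: `d(ω^{n-1}) = 0` (checked in every holomorphic chart). -/
def IsBalanced : Prop :=
  ∀ e ∈ IsManifold.maximalAtlas 𝓘(ℂ, CSpace n) ω M, ∀ z ∈ e.target,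
    extDeriv (fun w : CSpace n => formPow (g.kahlerForm e w) (n - 1)) z = 0

end HermitianMetric

end

/-!
The argument has three parts.

*Equality of the scalar curvatures.* Clearing denominators, the hypothesis says that the form
`α g(ξ, ξ̄) Ric⁽ᵏ⁾(ξ, ξ̄) + β R(ξ, ξ̄, ξ, ξ̄)` of bidegree `(2, 2)` vanishes at every point. Polarizing
it and taking the trace over a unitary frame gives `α (n + 1) tr Ric⁽ᵏ⁾ + β (u + v) = 0`
(`trace_mixed_curvature`), and `tr Ric⁽ᵏ⁾` is `u` for `k = 1, 2` and `v` for `k = 3, 4`. As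
`α (n + 1) = -2 β` and `β ≠ 0`, either case yields `u = v`
(`HermitianMetric.chernScalar_eq_alteredChernScalar`).

*Vanishing of the torsion form.* From `R_{i j̄ k}^p = -∂_{j̄} Γ_{ik}^p` one reads off
`u - v = -g^{i j̄} ∂_{j̄} ηᵢ` (`scalar_sub_alteredScalar`), so this trace of `∂̄η` is now zero. On the
other hand the cofactor matrix `det g · g^{k s̄}` satisfies `∂ₖ (det g · g^{k s̄}) = det g · g^{k s̄} ηₖ`
(`sum_dZ_adjugate`), so that the divergence of the vector field dual to `η` with respect to the
volume form `det g` is `|η|² + g^{i j̄} ∂_{j̄} ηᵢ = |η|²`. Its integral over the compact manifold `M` is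
zero, hence `η = 0` (`HermitianMetric.torsionTrace_eq_zero`). Integrals over `M` are never formed:
with a partition of unity `ρ`, one integrates `ρ_a |η|²` by parts in the chart of index `a`, inserts
`∑_b ρ_b = 1`, moves the terms to the charts of index `b` by a change of variables and uses that the
derivatives of the `ρ_a` add up to zero.

*The balanced condition.* The form `dz^k ∧ ω^{n-1}` is a linear combination of the cofactors
`det g · g^{k s̄}`, `s = 1, …, n`, with constant forms as coefficients that depend neither on the
metric nor on `k` (`wedgeSum_eq_sum_adjugate`). Therefore `∂(ω^{n-1})` is determined by the divergence
of the cofactor matrix, which is zero by the formula above once `η = 0`; the same holds for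
`∂̄(ω^{n-1})` (`extDeriv_formPow_eq_zero`).
-/

/-! ### Wirtinger calculus -/

section Wirtinger

variable {n : ℕ}

/-- The first order operator `(∂/∂xⁱ + c ∂/∂yⁱ) / 2`. It is `∂/∂zⁱ` for `c = -√-1` and `∂/∂z̄ⁱ` for
`c = √-1`, so that the rules of calculus need only be proved once. -/
noncomputable def wirt (c : ℂ) (i : Fin n) (f : CSpace n → ℂ) (z : CSpace n) : ℂ :=
  (fderiv ℝ f z (stdVec i) + c * fderiv ℝ f z (Complex.I • stdVec i)) / 2

lemma dZ_eq_wirt : (dZ : Fin n → (CSpace n → ℂ) → CSpace n → ℂ) = wirt (-Complex.I) := by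
  funext i f z; simp only [dZ, wirt]; ring

lemma dZbar_eq_wirt : (dZbar : Fin n → (CSpace n → ℂ) → CSpace n → ℂ) = wirt Complex.I := by
  funext i f z; simp only [dZbar, wirt]

variable {c d : ℂ} {i j : Fin n} {f h : CSpace n → ℂ} {z : CSpace n}

lemma wirt_congr (hfh : f =ᶠ[nhds z] h) : wirt c i f z = wirt c i h z := by
  simp only [wirt, hfh.fderiv_eq]

lemma wirt_const (a : ℂ) : wirt c i (fun _ => a) z = 0 := by simp [wirt]

lemma wirt_sub (hf : DifferentiableAt ℝ f z) (hh : DifferentiableAt ℝ h z) :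
    wirt c i (fun w => f w - h w) z = wirt c i f z - wirt c i h z := by
  simp only [wirt, fderiv_fun_sub hf hh, sub_apply]; ring

lemma wirt_mul (hf : DifferentiableAt ℝ f z) (hh : DifferentiableAt ℝ h z) :
    wirt c i (fun w => f w * h w) z = wirt c i f z * h z + f z * wirt c i h z := by
  simp only [wirt, fderiv_fun_mul hf hh, add_apply, smul_apply,
    smul_eq_mul]; ring

lemma wirt_const_mul (a : ℂ) (hf : DifferentiableAt ℝ f z) :
    wirt c i (fun w => a * f w) z = a * wirt c i f z := by
  rw [wirt_mul (differentiableAt_const a) hf, wirt_const]; ring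

lemma wirt_sum {ι : Type*} (s : Finset ι) {F : ι → CSpace n → ℂ}
    (hF : ∀ a ∈ s, DifferentiableAt ℝ (F a) z) :
    wirt c i (fun w => ∑ a ∈ s, F a w) z = ∑ a ∈ s, wirt c i (F a) z := by
  simp only [wirt, fderiv_fun_sum hF, sum_apply]
  rw [Finset.mul_sum, ← Finset.sum_add_distrib, Finset.sum_div]

lemma differentiableAt_finsetProd {ι : Type*} [DecidableEq ι] (s : Finset ι)
    {F : ι → CSpace n → ℂ} (hF : ∀ a ∈ s, DifferentiableAt ℝ (F a) z) :
    DifferentiableAt ℝ (fun w => ∏ a ∈ s, F a w) z :=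
  (HasFDerivAt.finsetProd fun a ha => (hF a ha).hasFDerivAt).differentiableAt

lemma wirt_prod {ι : Type*} [DecidableEq ι] (s : Finset ι) {F : ι → CSpace n → ℂ}
    (hF : ∀ a ∈ s, DifferentiableAt ℝ (F a) z) :
    wirt c i (fun w => ∏ a ∈ s, F a w) z
      = ∑ a ∈ s, (∏ b ∈ s.erase a, F b z) * wirt c i (F a) z := by
  have : fderiv ℝ (fun w => ∏ a ∈ s, F a w) z
      = ∑ a ∈ s, (∏ b ∈ s.erase a, F b z) • fderiv ℝ (F a) z :=
    fderiv_finsetProd hF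
  simp only [wirt, this, sum_apply, smul_apply,
    smul_eq_mul]
  rw [Finset.mul_sum, ← Finset.sum_add_distrib, Finset.sum_div]
  exact Finset.sum_congr rfl fun a _ => by ring

lemma contDiffAt_wirt (hf : ContDiffAt ℝ ∞ f z) : ContDiffAt ℝ ∞ (wirt c i f) z := by
  have h1 : ContDiffAt ℝ ∞ (fderiv ℝ f) z := hf.fderiv_right (by simp)
  unfold wirt
  exact (((h1.clm_apply contDiffAt_const).add
    (contDiffAt_const.mul (h1.clm_apply contDiffAt_const))).div_const 2)

lemma ContDiffAt.wirt_differentiableAt (hf : ContDiffAt ℝ ∞ f z) :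
    DifferentiableAt ℝ (wirt c i f) z :=
  (contDiffAt_wirt hf).differentiableAt (by simp)

lemma ContDiffAt.differentiableAt_infty (hf : ContDiffAt ℝ ∞ f z) : DifferentiableAt ℝ f z :=
  hf.differentiableAt (by simp)

lemma wirt_comm (hf : ContDiffAt ℝ ∞ f z) :
    wirt c i (wirt d j f) z = wirt d j (wirt c i f) z := by
  have h1 : DifferentiableAt ℝ (fderiv ℝ f) z :=
    (hf.fderiv_right (m := ∞) (by simp)).differentiableAt (by simp)
  have hs : IsSymmSndFDerivAt ℝ f z := hf.isSymmSndFDerivAt (by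
    simp only [minSmoothness_of_isRCLikeNormedField]; exact ENat.LEInfty.out)
  have key : ∀ (c' : ℂ) (i' : Fin n) (v : CSpace n),
      fderiv ℝ (wirt c' i' f) z v = (fderiv ℝ (fderiv ℝ f) z v (stdVec i')
        + c' * fderiv ℝ (fderiv ℝ f) z v (Complex.I • stdVec i')) / 2 := by
    intro c' i' v
    have h2 : ∀ u : CSpace n, HasFDerivAt (fun w => fderiv ℝ f w u)
        ((fderiv ℝ (fderiv ℝ f) z).flip u) z := fun u => by
      simpa using h1.hasFDerivAt.clm_apply (hasFDerivAt_const u z)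
    have h3 := (((h2 (stdVec i')).add
      ((h2 (Complex.I • stdVec i')).const_mul c')).mul_const (2⁻¹ : ℂ))
    have h4 : (wirt c' i' f) = fun w => (((fun w => fderiv ℝ f w (stdVec i')) +
        fun w => c' * fderiv ℝ f w (Complex.I • stdVec i')) w) * 2⁻¹ := by
      funext w; simp [wirt, div_eq_mul_inv]
    rw [h4, h3.fderiv]
    simp [div_eq_mul_inv]; ring
  simp only [wirt.eq_def c i (wirt d j f), wirt.eq_def d j (wirt c i f), key]
  rw [hs.eq (stdVec i) (stdVec j), hs.eq (stdVec i) (Complex.I • stdVec j),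
    hs.eq (Complex.I • stdVec i) (stdVec j), hs.eq (Complex.I • stdVec i) (Complex.I • stdVec j)]
  ring

lemma wirt_conj (c : ℂ) (i : Fin n) (f : CSpace n → ℂ) (z : CSpace n) :
    wirt c i (fun w => conj (f w)) z = conj (wirt (conj c) i f z) := by
  have : fderiv ℝ (fun w => conj (f w)) z = (Complex.conjCLE : ℂ →L[ℝ] ℂ).comp (fderiv ℝ f z) :=
    ContinuousLinearEquiv.comp_fderiv Complex.conjCLE
  simp [wirt, this, Complex.conj_ofNat]

lemma dZ_conj (i : Fin n) (f : CSpace n → ℂ) (z : CSpace n) :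
    dZ i (fun w => conj (f w)) z = conj (dZbar i f z) := by
  rw [dZ_eq_wirt, dZbar_eq_wirt, wirt_conj]; simp

lemma dZbar_conj (i : Fin n) (f : CSpace n → ℂ) (z : CSpace n) :
    dZbar i (fun w => conj (f w)) z = conj (dZ i f z) := by
  rw [dZ_eq_wirt, dZbar_eq_wirt, wirt_conj]; simp

/-- The decomposition `df = ∂f + ∂̄f`. -/
lemma realLinear_apply_eq_sum (L : CSpace n →L[ℝ] ℂ) (v : CSpace n) :
    L v = ∑ k, ((L (stdVec k) - Complex.I * L (Complex.I • stdVec k)) / 2 * v k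
      + (L (stdVec k) + Complex.I * L (Complex.I • stdVec k)) / 2 * conj (v k)) := by
  have hv : v = ∑ k, ((v k).re • stdVec k + (v k).im • (Complex.I • stdVec k) : CSpace n) := by
    ext k
    simp only [WithLp.ofLp_sum, Finset.sum_apply, WithLp.ofLp_add, WithLp.ofLp_smul, Pi.add_apply,
      Pi.smul_apply, stdVec, EuclideanSpace.single, Complex.real_smul]
    rw [Finset.sum_eq_single k]
    · simpa [mul_comm] using (Complex.re_add_im (v k)).symm
    · intro b _ hb; simp [Ne.symm hb]
    · simp
  conv_lhs => rw [hv]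
  rw [map_sum]
  refine Finset.sum_congr rfl fun k _ => ?_
  rw [map_add, map_smul, map_smul, Complex.real_smul, Complex.real_smul]
  conv_rhs => rw [← Complex.re_add_im (v k)]
  simp only [map_add, map_mul, Complex.conj_ofReal, Complex.conj_I]
  linear_combination ((v k).im * L (Complex.I • stdVec k)) * Complex.I_sq

lemma fderiv_apply_eq_sum (f : CSpace n → ℂ) (z v : CSpace n) :
    fderiv ℝ f z v = ∑ k, (dZ k f z * v k + dZbar k f z * conj (v k)) :=
  realLinear_apply_eq_sum _ v

/-- Jacobi's formula for the derivative of a determinant. -/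
lemma wirt_det {ι : Type*} [Fintype ι] [DecidableEq ι] {G : CSpace n → Matrix ι ι ℂ}
    (hG : ∀ a b, DifferentiableAt ℝ (fun w => G w a b) z) :
    wirt c i (fun w => (G w).det) z
      = ∑ a, ∑ b, (G z).adjugate b a * wirt c i (fun w => G w a b) z := by
  have h1 : wirt c i (fun w => (G w).det) z = ∑ b,
      ((G z).updateCol b (fun a => wirt c i (fun w => G w a b) z)).det := by
    simp only [Matrix.det_apply']
    rw [wirt_sum]
    swap
    · intro σ _
      exact (differentiableAt_const _).mul (differentiableAt_finsetProd _ fun b _ => hG _ _)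
    rw [Finset.sum_comm]
    refine Finset.sum_congr rfl fun σ _ => ?_
    rw [wirt_const_mul _ (differentiableAt_finsetProd _ fun b _ => hG _ _),
      wirt_prod _ (fun b _ => hG _ _), Finset.mul_sum]
    refine Finset.sum_congr rfl fun b _ => ?_
    congr 1
    rw [← Finset.prod_erase_mul _ _ (Finset.mem_univ b)]
    simp only [Matrix.updateCol_self]
    congr 1
    refine Finset.prod_congr rfl fun b' hb' => ?_
    rw [Matrix.updateCol_ne (Finset.ne_of_mem_erase hb')]
  rw [h1, Finset.sum_comm]
  refine Finset.sum_congr rfl fun b _ => ?_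
  rw [← Matrix.cramer_apply, Matrix.cramer_eq_adjugate_mulVec]
  rfl

/-- The chain rule for a holomorphic change of coordinates. -/
lemma wirt_comp_holomorphic {φ : CSpace n → CSpace n} {F : CSpace n → ℂ}
    (hφ : DifferentiableAt ℂ φ z) (hF : DifferentiableAt ℝ F (φ z)) (i : Fin n) :
    dZ i (fun w => F (φ w)) z = ∑ k, fderiv ℂ φ z (stdVec i) k * dZ k F (φ z) ∧
    dZbar i (fun w => F (φ w)) z
      = ∑ k, conj (fderiv ℂ φ z (stdVec i) k) * dZbar k F (φ z) := by
  have h1 : fderiv ℝ φ z = (fderiv ℂ φ z).restrictScalars ℝ := hφ.fderiv_restrictScalars ℝ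
  have h2 : ∀ v, fderiv ℝ (fun w => F (φ w)) z v = fderiv ℝ F (φ z) (fderiv ℂ φ z v) := by
    intro v
    have := fderiv_comp (𝕜 := ℝ) (g := F) (f := φ) z hF (hφ.restrictScalars ℝ)
    rw [Function.comp_def] at this
    rw [this, h1]; rfl
  have h3 : fderiv ℂ φ z (Complex.I • stdVec i) = Complex.I • fderiv ℂ φ z (stdVec i) := map_smul _ _ _
  constructor
  · simp only [dZ.eq_def i, h2, h3]
    rw [fderiv_apply_eq_sum, fderiv_apply_eq_sum, Finset.mul_sum, ← Finset.sum_sub_distrib,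
      Finset.sum_div]
    refine Finset.sum_congr rfl fun k _ => ?_
    simp only [PiLp.smul_apply, smul_eq_mul, map_mul, Complex.conj_I]
    linear_combination (-dZ k F (φ z) * (fderiv ℂ φ z (stdVec i) k)
      + dZbar k F (φ z) * conj (fderiv ℂ φ z (stdVec i) k)) / 2 * Complex.I_sq
  · simp only [dZbar.eq_def i, h2, h3]
    rw [fderiv_apply_eq_sum, fderiv_apply_eq_sum, Finset.mul_sum, ← Finset.sum_add_distrib,
      Finset.sum_div]
    refine Finset.sum_congr rfl fun k _ => ?_
    simp only [PiLp.smul_apply, smul_eq_mul, map_mul, Complex.conj_I]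
    linear_combination (dZ k F (φ z) * (fderiv ℂ φ z (stdVec i) k)
      - dZbar k F (φ z) * conj (fderiv ℂ φ z (stdVec i) k)) / 2 * Complex.I_sq

end Wirtinger

/-! ### The Chern connection of a matrix of metric coefficients -/

section MetricMatrix

variable {n : ℕ}

/-- The inverse coefficients `g^{p q̄}` of the metric with coefficients `g_{i j̄} = G i j`. -/
noncomputable def metricInv (G : CSpace n → Matrix (Fin n) (Fin n) ℂ) (z : CSpace n) :
    Matrix (Fin n) (Fin n) ℂ := ((G z)ᵀ)⁻¹

/-- The Christoffel symbols `Γ_{ik}^p = g^{p q̄} ∂ᵢ g_{k q̄}` of the Chern connection. -/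
noncomputable def christoffel (G : CSpace n → Matrix (Fin n) (Fin n) ℂ) (i k p : Fin n)
    (z : CSpace n) : ℂ :=
  ∑ q, metricInv G z p q * dZ i (fun w => G w k q) z

/-- The coefficients `ηᵢ = ∑ₖ T_{ik}^k` of the torsion `(1,0)`-form. -/
noncomputable def torsionTrace (G : CSpace n → Matrix (Fin n) (Fin n) ℂ) (i : Fin n)
    (z : CSpace n) : ℂ :=
  ∑ k, ∑ l, metricInv G z k l * (dZ i (fun w => G w k l) z - dZ k (fun w => G w i l) z)

/-- The curvature coefficients `R_{i j̄ k l̄}` of the Chern connection. -/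
noncomputable def curvCoeff (G : CSpace n → Matrix (Fin n) (Fin n) ℂ) (z : CSpace n)
    (i j k l : Fin n) : ℂ :=
  - dZ i (dZbar j (fun w => G w k l)) z
    + ∑ p, ∑ q, metricInv G z p q * dZ i (fun w => G w k q) z * dZbar j (fun w => G w p l) z

/-- The trace `g^{k l̄} A_{k l̄}`, for the inverse coefficients `H k l = g^{k l̄}`. -/
def traceH {n : ℕ} (H A : Matrix (Fin n) (Fin n) ℂ) : ℂ := ∑ k, ∑ l, H k l * A k l

variable {G : CSpace n → Matrix (Fin n) (Fin n) ℂ} {z : CSpace n}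

lemma torsionTrace_eq_christoffel (i : Fin n) (z : CSpace n) :
    torsionTrace G i z = ∑ k, (christoffel G i k k z - christoffel G k i k z) := by
  simp only [torsionTrace, christoffel, ← Finset.sum_sub_distrib, mul_sub]

lemma contDiffAt_det {ι : Type*} [Fintype ι] [DecidableEq ι] {A : CSpace n → Matrix ι ι ℂ}
    (hA : ∀ a b, ContDiffAt ℝ ∞ (fun w => A w a b) z) :
    ContDiffAt ℝ ∞ (fun w => (A w).det) z := by
  simp only [Matrix.det_apply']
  exact ContDiffAt.sum fun σ _ => contDiffAt_const.mul (contDiffAt_prod fun b _ => hA _ _)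

lemma contDiffAt_adjugate (hG : ∀ a b, ContDiffAt ℝ ∞ (fun w => G w a b) z) (a b : Fin n) :
    ContDiffAt ℝ ∞ (fun w => (G w).adjugate a b) z := by
  simp only [Matrix.adjugate_apply]
  refine contDiffAt_det fun a' b' => ?_
  by_cases h : a' = b
  · subst h; simpa using contDiffAt_const
  · simpa [Matrix.updateRow_ne h] using hG a' b'

lemma adjugate_eq_det_mul_metricInv (hdet : (G z).det ≠ 0) (a b : Fin n) :
    (G z).adjugate a b = (G z).det * metricInv G z b a := by
  rw [metricInv, Matrix.inv_def, Matrix.det_transpose, Ring.inverse_eq_inv', Matrix.smul_apply,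
    ← Matrix.adjugate_transpose, Matrix.transpose_apply, smul_eq_mul, mul_inv_cancel_left₀ hdet]

lemma metricInv_eq (a b : Fin n) :
    metricInv G z a b = ((G z).det)⁻¹ * (G z).adjugate b a := by
  rw [metricInv, Matrix.inv_def, Matrix.det_transpose, Ring.inverse_eq_inv', Matrix.smul_apply,
    ← Matrix.adjugate_transpose, Matrix.transpose_apply, smul_eq_mul]

lemma contDiffAt_metricInv (hG : ∀ a b, ContDiffAt ℝ ∞ (fun w => G w a b) z)
    (hdet : (G z).det ≠ 0) (a b : Fin n) :
    ContDiffAt ℝ ∞ (fun w => metricInv G w a b) z := by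
  simp only [metricInv_eq]
  exact ((contDiffAt_det hG).inv hdet).mul (contDiffAt_adjugate hG b a)

lemma sum_metricInv_mul (hdet : (G z).det ≠ 0) (p k : Fin n) :
    ∑ q, metricInv G z p q * G z k q = if p = k then 1 else 0 := by
  have h : metricInv G z * (G z)ᵀ = 1 :=
    Matrix.nonsing_inv_mul _ (by rw [Matrix.det_transpose]; exact hdet.isUnit)
  have := congrFun (congrFun h p) k
  simpa [Matrix.mul_apply, Matrix.one_apply] using this

lemma sum_mul_metricInv (hdet : (G z).det ≠ 0) (q l : Fin n) :
    ∑ k, G z k q * metricInv G z k l = if q = l then 1 else 0 := by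
  have h : (G z)ᵀ * metricInv G z = 1 :=
    Matrix.mul_nonsing_inv _ (by rw [Matrix.det_transpose]; exact hdet.isUnit)
  have := congrFun (congrFun h q) l
  simpa [Matrix.mul_apply, Matrix.one_apply] using this

lemma eventually_det_ne_zero (hG : ∀ a b, ContDiffAt ℝ ∞ (fun w => G w a b) z)
    (hdet : (G z).det ≠ 0) : ∀ᶠ w in nhds z, (G w).det ≠ 0 :=
  (contDiffAt_det hG).continuousAt.eventually_ne hdet

lemma wirt_metricInv (hG : ∀ a b, ContDiffAt ℝ ∞ (fun w => G w a b) z)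
    (hdet : (G z).det ≠ 0) (c : ℂ) (i p q : Fin n) :
    wirt c i (fun w => metricInv G w p q) z = -∑ a, ∑ b, metricInv G z p b *
      wirt c i (fun w => G w a b) z * metricInv G z a q := by
  have hH := fun a b => (contDiffAt_metricInv hG hdet a b).differentiableAt_infty
  have hG' := fun a b => (hG a b).differentiableAt_infty
  -- the derivative of `∑_b g^{p b̄} g_{a b̄} = δ_{pa}`
  have h1 : ∀ a, ∑ b, (wirt c i (fun w => metricInv G w p b) z * G z a b
      + metricInv G z p b * wirt c i (fun w => G w a b) z) = 0 := by
    intro a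
    have h2 : (fun w => ∑ b, metricInv G w p b * G w a b) =ᶠ[nhds z]
        fun _ => if p = a then 1 else 0 := by
      filter_upwards [eventually_det_ne_zero hG hdet] with w hw using sum_metricInv_mul hw p a
    have h3 := wirt_congr (c := c) (i := i) h2
    rw [wirt_const, wirt_sum _ fun b _ => (hH p b).fun_mul (hG' a b)] at h3
    rw [← h3]
    exact Finset.sum_congr rfl fun b _ => (wirt_mul (hH p b) (hG' a b)).symm
  have h4 : ∑ a, (∑ b, (wirt c i (fun w => metricInv G w p b) z * G z a b
      + metricInv G z p b * wirt c i (fun w => G w a b) z)) * metricInv G z a q = 0 := by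
    simp [h1]
  simp only [Finset.sum_add_distrib, add_mul, Finset.sum_mul] at h4
  rw [Finset.sum_comm] at h4
  simp only [mul_assoc, ← Finset.mul_sum, sum_mul_metricInv hdet] at h4
  simp only [mul_ite, mul_one, mul_zero, Finset.sum_ite_eq', Finset.mem_univ, if_true] at h4
  rw [eq_neg_iff_add_eq_zero, ← h4]
  simp only [mul_assoc]

lemma contDiffAt_christoffel (hG : ∀ a b, ContDiffAt ℝ ∞ (fun w => G w a b) z)
    (hdet : (G z).det ≠ 0) (i k p : Fin n) : ContDiffAt ℝ ∞ (christoffel G i k p) z := by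
  unfold christoffel
  refine ContDiffAt.sum fun q _ => (contDiffAt_metricInv hG hdet p q).mul ?_
  rw [dZ_eq_wirt]
  exact contDiffAt_wirt (hG k q)

lemma contDiffAt_torsionTrace (hG : ∀ a b, ContDiffAt ℝ ∞ (fun w => G w a b) z)
    (hdet : (G z).det ≠ 0) (i : Fin n) : ContDiffAt ℝ ∞ (torsionTrace G i) z := by
  have : torsionTrace G i
      = fun z => ∑ k, (christoffel G i k k z - christoffel G k i k z) :=
    funext (torsionTrace_eq_christoffel i)
  rw [this]
  exact ContDiffAt.sum fun k _ =>
    (contDiffAt_christoffel hG hdet i k k).sub (contDiffAt_christoffel hG hdet k i k)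

/-- `R_{i j̄ k}^p = -∂_{j̄} Γ_{ik}^p`. -/
lemma sum_metricInv_mul_curvCoeff (hG : ∀ a b, ContDiffAt ℝ ∞ (fun w => G w a b) z)
    (hdet : (G z).det ≠ 0) (i j k p : Fin n) :
    ∑ l, metricInv G z p l * curvCoeff G z i j k l = -dZbar j (christoffel G i k p) z := by
  have hH := fun a b => (contDiffAt_metricInv hG hdet a b).differentiableAt_infty
  have h1 : christoffel G i k p = fun w => ∑ q, metricInv G w p q *
      wirt (-Complex.I) i (fun w => G w k q) w := by
    funext w; simp only [christoffel, dZ_eq_wirt]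
  rw [h1]
  simp only [curvCoeff, dZ_eq_wirt, dZbar_eq_wirt]
  rw [wirt_sum _ fun q _ => (hH p q).fun_mul (hG k q).wirt_differentiableAt, ← Finset.sum_neg_distrib]
  simp only [wirt_mul (hH _ _) (hG _ _).wirt_differentiableAt, wirt_metricInv hG hdet,
    mul_add, Finset.sum_add_distrib, neg_add, wirt_comm (c := Complex.I) (hG k _), mul_neg,
    neg_mul, neg_neg, Finset.sum_neg_distrib]
  rw [add_comm]
  congr 1
  simp only [Finset.mul_sum, Finset.sum_mul]
  rw [Finset.sum_comm, Finset.sum_congr rfl fun a _ => Finset.sum_comm, Finset.sum_comm]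
  exact Finset.sum_congr rfl fun q _ => Finset.sum_congr rfl fun a _ =>
    Finset.sum_congr rfl fun b _ => by ring

/-- The two scalar curvatures differ by the trace of `∂̄η`. -/
lemma scalar_sub_alteredScalar (hG : ∀ a b, ContDiffAt ℝ ∞ (fun w => G w a b) z)
    (hdet : (G z).det ≠ 0) :
    (∑ i, ∑ j, metricInv G z i j * ∑ k, ∑ l, metricInv G z k l * curvCoeff G z i j k l)
      - (∑ i, ∑ l, metricInv G z i l * ∑ k, ∑ j, metricInv G z k j * curvCoeff G z i j k l)
      = -traceH (metricInv G z) (Matrix.of fun i j => dZbar j (torsionTrace G i) z) := by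
  have hΓ := fun i k p => (contDiffAt_christoffel hG hdet i k p).differentiableAt_infty
  have h1 : ∀ i j, dZbar j (torsionTrace G i) z
      = ∑ k, (dZbar j (christoffel G i k k) z - dZbar j (christoffel G k i k) z) := by
    intro i j
    have : torsionTrace G i
      = fun z => ∑ k, (christoffel G i k k z - christoffel G k i k z) :=
      funext (torsionTrace_eq_christoffel i)
    rw [this, dZbar_eq_wirt, wirt_sum _ fun k _ => (hΓ i k k).fun_sub (hΓ k i k)]
    exact Finset.sum_congr rfl fun k _ => wirt_sub (hΓ i k k) (hΓ k i k)
  have h2 : ∑ i, ∑ l, metricInv G z i l * ∑ k, ∑ j, metricInv G z k j * curvCoeff G z i j k l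
      = ∑ k, ∑ j, metricInv G z k j * ∑ i, ∑ l, metricInv G z i l * curvCoeff G z i j k l := by
    simp only [Finset.mul_sum]
    rw [Finset.sum_congr rfl fun i _ => Finset.sum_comm, Finset.sum_comm]
    refine Finset.sum_congr rfl fun k _ => ?_
    rw [Finset.sum_congr rfl fun i _ => Finset.sum_comm, Finset.sum_comm]
    refine Finset.sum_congr rfl fun j _ => Finset.sum_congr rfl fun i _ =>
      Finset.sum_congr rfl fun l _ => by ring
  rw [h2]
  simp only [sum_metricInv_mul_curvCoeff hG hdet, traceH, Matrix.of_apply, h1,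
    Finset.sum_sub_distrib, mul_sub, Finset.sum_neg_distrib, mul_neg]
  ring

/-- The divergence of the cofactor matrix: `∑ₖ ∂ₖ (det g · g^{k s̄}) = ∑ₖ det g · g^{k s̄} ηₖ`. -/
lemma sum_dZ_adjugate (hG : ∀ a b, ContDiffAt ℝ ∞ (fun w => G w a b) z)
    (hdet : (G z).det ≠ 0) (s : Fin n) :
    ∑ k, dZ k (fun w => (G w).adjugate s k) z = ∑ k, (G z).adjugate s k * torsionTrace G k z := by
  have hH := fun a b => (contDiffAt_metricInv hG hdet a b).differentiableAt_infty
  have hD := (contDiffAt_det hG).differentiableAt_infty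
  have h1 : ∀ k, dZ k (fun w => (G w).adjugate s k) z
      = (G z).det * ∑ a, ∑ b, (metricInv G z k s * metricInv G z a b * dZ k (fun w => G w a b) z
        - metricInv G z k b * metricInv G z a s * dZ k (fun w => G w a b) z) := by
    intro k
    have h2 : (fun w => (G w).adjugate s k) =ᶠ[nhds z]
        fun w => (G w).det * metricInv G w k s := by
      filter_upwards [eventually_det_ne_zero hG hdet] with w hw
        using adjugate_eq_det_mul_metricInv hw s k
    rw [dZ_eq_wirt, wirt_congr h2, wirt_mul hD (hH k s),
      wirt_det fun a b => (hG a b).differentiableAt_infty, wirt_metricInv hG hdet]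
    simp only [adjugate_eq_det_mul_metricInv hdet, Finset.sum_mul, Finset.mul_sum, mul_neg]
    rw [← sub_eq_add_neg, ← Finset.sum_sub_distrib]
    refine Finset.sum_congr rfl fun a _ => ?_
    rw [← Finset.sum_sub_distrib]
    exact Finset.sum_congr rfl fun b _ => by ring
  have h3 : ∑ k, ∑ a, ∑ b, metricInv G z k b * metricInv G z a s * dZ k (fun w => G w a b) z
      = ∑ k, ∑ a, ∑ b, metricInv G z k s * metricInv G z a b * dZ a (fun w => G w k b) z := by
    rw [Finset.sum_comm]
    exact Finset.sum_congr rfl fun k _ => Finset.sum_congr rfl fun a _ =>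
      Finset.sum_congr rfl fun b _ => by ring
  simp only [h1]
  rw [← Finset.mul_sum]
  simp only [Finset.sum_sub_distrib]
  rw [h3]
  simp only [← Finset.sum_sub_distrib]
  rw [Finset.mul_sum]
  refine Finset.sum_congr rfl fun k _ => ?_
  rw [adjugate_eq_det_mul_metricInv hdet, torsionTrace, mul_assoc]
  congr 1
  rw [Finset.mul_sum]
  refine Finset.sum_congr rfl fun a _ => ?_
  rw [Finset.mul_sum]
  exact Finset.sum_congr rfl fun b _ => by ring

lemma Matrix.IsHermitian.conj_adjugate {A : Matrix (Fin n) (Fin n) ℂ} (hA : A.IsHermitian)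
    (a b : Fin n) : conj (A.adjugate a b) = A.adjugate b a := by
  have h : A.adjugateᴴ = A.adjugate := by rw [Matrix.adjugate_conjTranspose, hA.eq]
  exact congrFun (congrFun h b) a

lemma sum_dZbar_adjugate (hG : ∀ a b, ContDiffAt ℝ ∞ (fun w => G w a b) z)
    (hdet : (G z).det ≠ 0) (hherm : ∀ᶠ w in nhds z, (G w).IsHermitian) (k : Fin n) :
    ∑ s, dZbar s (fun w => (G w).adjugate s k) z
      = ∑ s, (G z).adjugate s k * conj (torsionTrace G s z) := by
  have h1 : ∀ s, dZbar s (fun w => (G w).adjugate s k) z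
      = conj (dZ s (fun w => (G w).adjugate k s) z) := by
    intro s
    rw [← dZbar_conj, dZbar_eq_wirt]
    refine wirt_congr ?_
    filter_upwards [hherm] with w hw using (hw.conj_adjugate k s).symm
  simp only [h1, ← map_sum, sum_dZ_adjugate hG hdet k]
  rw [map_sum]
  exact Finset.sum_congr rfl fun s _ => by
    rw [map_mul, hherm.self_of_nhds.conj_adjugate]

/-- The divergence of `h η^♯`, for the vector field `η^♯` dual to `η` and the volume form `det g`, when
the trace of `∂̄η` vanishes. -/
lemma divergence_torsionTrace (hG : ∀ a b, ContDiffAt ℝ ∞ (fun w => G w a b) z)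
    (hdet : (G z).det ≠ 0) (hherm : ∀ᶠ w in nhds z, (G w).IsHermitian)
    (htr : traceH (metricInv G z) (Matrix.of fun i j => dZbar j (torsionTrace G i) z) = 0)
    {h : CSpace n → ℂ} (hh : DifferentiableAt ℝ h z) :
    ∑ s, dZbar s (fun w => h w * ∑ k, (G w).adjugate s k * torsionTrace G k w) z
      = (G z).det * (h z * traceH (metricInv G z)
          (Matrix.of fun i j => torsionTrace G i z * conj (torsionTrace G j z))
        + traceH (metricInv G z) (Matrix.of fun i j => torsionTrace G i z * dZbar j h z)) := by
  have hA := fun a b => (contDiffAt_adjugate hG a b).differentiableAt_infty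
  have hη := fun a => (contDiffAt_torsionTrace hG hdet a).differentiableAt_infty
  have h1 : ∀ s, dZbar s (fun w => h w * ∑ k, (G w).adjugate s k * torsionTrace G k w) z
      = ∑ k, (h z * torsionTrace G k z * dZbar s (fun w => (G w).adjugate s k) z
        + h z * ((G z).adjugate s k * dZbar s (torsionTrace G k) z)
        + (G z).adjugate s k * torsionTrace G k z * dZbar s h z) := by
    intro s
    rw [dZbar_eq_wirt, wirt_mul hh (DifferentiableAt.fun_sum fun k _ => (hA s k).fun_mul (hη k)),
      wirt_sum _ fun k _ => (hA s k).fun_mul (hη k)]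
    simp only [wirt_mul (hA s _) (hη _), Finset.mul_sum]
    rw [← Finset.sum_add_distrib]
    exact Finset.sum_congr rfl fun k _ => by ring
  have h2 : ∑ s, ∑ k, (G z).adjugate s k * dZbar s (torsionTrace G k) z = 0 := by
    rw [Finset.sum_comm]
    simp only [adjugate_eq_det_mul_metricInv hdet, mul_assoc, ← Finset.mul_sum]
    simp only [traceH, Matrix.of_apply] at htr
    rw [htr, mul_zero]
  simp only [h1, Finset.sum_add_distrib]
  rw [Finset.sum_comm]
  simp only [← Finset.mul_sum, sum_dZbar_adjugate hG hdet hherm, h2, mul_zero, add_zero]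
  rw [mul_add]
  congr 1
  · simp only [traceH, Matrix.of_apply, Finset.mul_sum, adjugate_eq_det_mul_metricInv hdet]
    exact Finset.sum_congr rfl fun k _ => Finset.sum_congr rfl fun a _ => by ring
  · rw [Finset.sum_comm]
    simp only [traceH, Matrix.of_apply, Finset.mul_sum, adjugate_eq_det_mul_metricInv hdet]
    exact Finset.sum_congr rfl fun k _ => Finset.sum_congr rfl fun a _ => by ring

end MetricMatrix

open scoped ComplexOrder

/-! ### Polarization and traces of the curvature condition -/

section Polarization

variable {n : ℕ}

/-- Polarization of a quartic form of bidegree `(2,2)`: averaging `Q (x + t y)` over the fourth roots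
of unity `t` keeps only the terms of equal degree in `t` and `t̄`. -/
lemma polarize_quartic (A : Fin n → Fin n → Fin n → Fin n → ℂ)
    (hA : ∀ ξ : Fin n → ℂ,
      ∑ i, ∑ j, ∑ k, ∑ l, A i j k l * (ξ i * conj (ξ j) * ξ k * conj (ξ l)) = 0)
    (x y : Fin n → ℂ) :
    ∑ i, ∑ j, ∑ k, ∑ l, A i j k l * (x i * conj (x j) * (y k * conj (y l))
      + x i * conj (x l) * (y k * conj (y j)) + x k * conj (x j) * (y i * conj (y l))
      + x k * conj (x l) * (y i * conj (y j))) = 0 := by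
  let Q : (Fin n → ℂ) → ℂ := fun ξ =>
    ∑ i, ∑ j, ∑ k, ∑ l, A i j k l * (ξ i * conj (ξ j) * ξ k * conj (ξ l))
  have hQ : ∀ ξ, Q ξ = 0 := hA
  have h7 : (4 : ℂ) * ∑ i, ∑ j, ∑ k, ∑ l, A i j k l * (x i * conj (x j) * (y k * conj (y l))
      + x i * conj (x l) * (y k * conj (y j)) + x k * conj (x j) * (y i * conj (y l))
      + x k * conj (x l) * (y i * conj (y j)))
      = Q (fun i => x i + y i) + Q (fun i => x i + Complex.I * y i) + Q (fun i => x i - y i)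
        + Q (fun i => x i - Complex.I * y i) - 4 * Q x - 4 * Q y := by
    simp only [Q]
    simp only [Finset.mul_sum, ← Finset.sum_add_distrib, ← Finset.sum_sub_distrib]
    refine Finset.sum_congr rfl fun i _ => Finset.sum_congr rfl fun j _ =>
      Finset.sum_congr rfl fun k _ => Finset.sum_congr rfl fun l _ => ?_
    simp only [map_add, map_sub, map_mul, Complex.conj_I]
    have hI : Complex.I ^ 2 = -1 := Complex.I_sq
    have hI4 : Complex.I ^ 4 = 1 := Complex.I_pow_four
    ring_nf
    simp only [hI, hI4]
    ring
  simpa [hQ] using h7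

/-- The trace of the symmetrization of a quartic form that vanishes on the diagonal. -/
lemma trace_quartic_eq_zero (A : Fin n → Fin n → Fin n → Fin n → ℂ)
    (hA : ∀ ξ : Fin n → ℂ,
      ∑ i, ∑ j, ∑ k, ∑ l, A i j k l * (ξ i * conj (ξ j) * ξ k * conj (ξ l)) = 0)
    (B : Matrix (Fin n) (Fin n) ℂ) :
    ∑ i, ∑ j, ∑ k, ∑ l, A i j k l * ((B * Bᴴ) i j * (B * Bᴴ) k l
      + (B * Bᴴ) i l * (B * Bᴴ) k j) = 0 := by
  have h1 : ∑ a, ∑ b, ∑ i, ∑ j, ∑ k, ∑ l, A i j k l *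
      (B i a * conj (B j a) * (B k b * conj (B l b))
      + B i a * conj (B l a) * (B k b * conj (B j b))
      + B k a * conj (B j a) * (B i b * conj (B l b))
      + B k a * conj (B l a) * (B i b * conj (B j b))) = 0 :=
    Finset.sum_eq_zero fun a _ => Finset.sum_eq_zero fun b _ =>
      polarize_quartic A hA (fun i => B i a) (fun i => B i b)
  have h2 : ∀ i j k l, ∑ a, ∑ b, B i a * conj (B j a) * (B k b * conj (B l b))
      = (B * Bᴴ) i j * (B * Bᴴ) k l := by
    intro i j k l
    simp only [Matrix.mul_apply, Matrix.conjTranspose_apply, Finset.sum_mul_sum]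
    rfl
  have h3 : ∑ a, ∑ b, ∑ i, ∑ j, ∑ k, ∑ l, A i j k l *
      (B i a * conj (B j a) * (B k b * conj (B l b))
      + B i a * conj (B l a) * (B k b * conj (B j b))
      + B k a * conj (B j a) * (B i b * conj (B l b))
      + B k a * conj (B l a) * (B i b * conj (B j b)))
      = ∑ i, ∑ j, ∑ k, ∑ l, A i j k l * (∑ a, ∑ b,
      (B i a * conj (B j a) * (B k b * conj (B l b))
      + B i a * conj (B l a) * (B k b * conj (B j b))
      + B k a * conj (B j a) * (B i b * conj (B l b))
      + B k a * conj (B l a) * (B i b * conj (B j b)))) := by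
    simp only [Finset.mul_sum]
    have pull : ∀ F : Fin n → Fin n → Fin n → Fin n → Fin n → ℂ,
        ∑ b, ∑ i, ∑ j, ∑ k, ∑ l, F b i j k l = ∑ i, ∑ j, ∑ k, ∑ l, ∑ b, F b i j k l := by
      intro F
      rw [Finset.sum_comm]
      refine Finset.sum_congr rfl fun i _ => ?_
      rw [Finset.sum_comm]
      refine Finset.sum_congr rfl fun j _ => ?_
      rw [Finset.sum_comm]
      refine Finset.sum_congr rfl fun k _ => ?_
      rw [Finset.sum_comm]
    rw [Finset.sum_congr rfl fun a _ => pull _, pull]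
  rw [h3] at h1
  simp only [Finset.sum_add_distrib, h2] at h1
  have h4 : (2 : ℂ) * ∑ i, ∑ j, ∑ k, ∑ l, A i j k l * ((B * Bᴴ) i j * (B * Bᴴ) k l
      + (B * Bᴴ) i l * (B * Bᴴ) k j) = 0 := by
    rw [← h1]
    simp only [Finset.mul_sum]
    refine Finset.sum_congr rfl fun i _ => Finset.sum_congr rfl fun j _ =>
      Finset.sum_congr rfl fun k _ => Finset.sum_congr rfl fun l _ => by ring
  simpa using h4

open scoped MatrixOrder in
lemma Matrix.PosSemidef.exists_eq_mul_conjTranspose {H : Matrix (Fin n) (Fin n) ℂ}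
    (hH : H.PosSemidef) : ∃ B : Matrix (Fin n) (Fin n) ℂ, H = B * Bᴴ := by
  obtain ⟨B, rfl⟩ := CStarAlgebra.nonneg_iff_eq_star_mul_self.mp hH.nonneg
  exact ⟨Bᴴ, by rw [Matrix.conjTranspose_conjTranspose]; rfl⟩

/-- Tracing `α |ξ|² ρ(ξ, ξ̄) + β R(ξ, ξ̄, ξ, ξ̄) = 0` over a unitary frame. -/
lemma trace_mixed_curvature {G : Matrix (Fin n) (Fin n) ℂ} (hG : G.PosDef)
    (R : Fin n → Fin n → Fin n → Fin n → ℂ) (ρ : Fin n → Fin n → ℂ) (α β : ℂ)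
    (h : ∀ ξ : Fin n → ℂ,
      α * (∑ i, ∑ j, G i j * (ξ i * conj (ξ j))) * (∑ k, ∑ l, ρ k l * (ξ k * conj (ξ l)))
        + β * ∑ i, ∑ j, ∑ k, ∑ l, R i j k l * (ξ i * conj (ξ j) * ξ k * conj (ξ l)) = 0) :
    α * (n + 1) * traceH (Gᵀ)⁻¹ (Matrix.of ρ)
      + β * ((∑ i, ∑ j, ∑ k, ∑ l, (Gᵀ)⁻¹ i j * (Gᵀ)⁻¹ k l * R i j k l)
        + ∑ i, ∑ j, ∑ k, ∑ l, (Gᵀ)⁻¹ i l * (Gᵀ)⁻¹ k j * R i j k l) = 0 := by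
  have hH : ((Gᵀ)⁻¹).PosDef := hG.transpose.inv
  obtain ⟨B, hB⟩ := hH.posSemidef.exists_eq_mul_conjTranspose
  have hdet : G.det ≠ 0 := hG.det_pos.ne'
  set H := (Gᵀ)⁻¹ with hHdef
  have hGH : ∀ q l, ∑ k, G k q * H k l = if q = l then 1 else 0 :=
    fun q l => sum_mul_metricInv (G := fun _ => G) (z := 0) hdet q l
  have key := trace_quartic_eq_zero (fun i j k l => α * (G i j * ρ k l) + β * R i j k l) ?_ B
  swap
  · intro ξ
    rw [← h ξ, mul_assoc α]
    simp only [Finset.sum_mul]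
    simp only [Finset.mul_sum, ← Finset.sum_add_distrib]
    refine Finset.sum_congr rfl fun i _ => Finset.sum_congr rfl fun j _ =>
      Finset.sum_congr rfl fun k _ => Finset.sum_congr rfl fun l _ => by ring
  rw [← hB] at key
  have t1 : ∑ i, ∑ j, ∑ k, ∑ l, G i j * ρ k l * (H i j * H k l) = n * traceH H (Matrix.of ρ) := by
    have h1 : ∑ j, ∑ i, G i j * H i j = (n : ℂ) := by
      simp [hGH]
    rw [← h1, Finset.sum_comm (f := fun j i => G i j * H i j)]
    simp only [traceH, Finset.sum_mul, Matrix.of_apply]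
    simp only [Finset.mul_sum]
    refine Finset.sum_congr rfl fun i _ => Finset.sum_congr rfl fun j _ =>
      Finset.sum_congr rfl fun k _ => Finset.sum_congr rfl fun l _ => by ring
  have t2 : ∑ i, ∑ j, ∑ k, ∑ l, G i j * ρ k l * (H i l * H k j) = traceH H (Matrix.of ρ) := by
    have h1 : ∀ k l, ∑ j, H k j * ∑ i, G i j * H i l = H k l := by
      intro k l; simp [hGH]
    have h2 : traceH H (Matrix.of ρ) = ∑ k, ∑ l, ∑ j, ∑ i, G i j * ρ k l * (H i l * H k j) := by
      rw [traceH]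
      refine Finset.sum_congr rfl fun k _ => Finset.sum_congr rfl fun l _ => ?_
      rw [← h1, Finset.sum_mul]
      refine Finset.sum_congr rfl fun j _ => ?_
      rw [Finset.mul_sum, Finset.sum_mul]
      refine Finset.sum_congr rfl fun i _ => ?_
      rw [Matrix.of_apply]; ring
    rw [h2]
    rw [Finset.sum_comm]
    have c1 : ∀ F : Fin n → Fin n → Fin n → ℂ,
        ∑ j, ∑ k, ∑ l, F j k l = ∑ k, ∑ l, ∑ j, F j k l := by
      intro F
      rw [Finset.sum_comm]
      exact Finset.sum_congr rfl fun k _ => Finset.sum_comm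
    rw [Finset.sum_congr rfl fun j _ => c1 _, c1]
  simp only [add_mul, mul_add, Finset.sum_add_distrib] at key
  have e1 : ∀ (c : ℂ) (F P : Fin n → Fin n → Fin n → Fin n → ℂ),
      ∑ i, ∑ j, ∑ k, ∑ l, c * F i j k l * P i j k l
        = c * ∑ i, ∑ j, ∑ k, ∑ l, F i j k l * P i j k l := by
    intro c F P
    simp only [Finset.mul_sum, mul_assoc]
  have e2 : ∀ (F P : Fin n → Fin n → Fin n → Fin n → ℂ),
      ∑ i, ∑ j, ∑ k, ∑ l, F i j k l * P i j k l = ∑ i, ∑ j, ∑ k, ∑ l, P i j k l * F i j k l := by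
    intro F P
    simp only [mul_comm]
  rw [e1, e1, e1, e1, t1, t2, e2 R, e2 R] at key
  linear_combination key

end Polarization

/-! ### Holomorphic changes of coordinates -/

section Transition

variable {n : ℕ}

/-- The Jacobian matrix `(∂φᵏ/∂zⁱ)` of a holomorphic map. -/
noncomputable def jac (φ : CSpace n → CSpace n) (w : CSpace n) : Matrix (Fin n) (Fin n) ℂ :=
  Matrix.of fun k i => fderiv ℂ φ w (stdVec i) k

/-- The coefficients `∑ J_{ka} A_{k l} conj J_{lb}` of the pullback of a sesquilinear form. -/
def sesqPullback (J A : Matrix (Fin n) (Fin n) ℂ) : Matrix (Fin n) (Fin n) ℂ :=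
  Jᵀ * A * J.map (starRingEnd ℂ)

lemma sesqPullback_apply (J A : Matrix (Fin n) (Fin n) ℂ) (a b : Fin n) :
    sesqPullback J A a b = ∑ k, ∑ l, J k a * conj (J l b) * A k l := by
  simp only [sesqPullback, Matrix.mul_apply, Matrix.transpose_apply, Matrix.map_apply,
    Finset.sum_mul]
  rw [Finset.sum_comm]
  exact Finset.sum_congr rfl fun k _ => Finset.sum_congr rfl fun l _ => by ring

lemma det_sesqPullback (J A : Matrix (Fin n) (Fin n) ℂ) :
    (sesqPullback J A).det = Complex.normSq J.det * A.det := by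
  have : (J.map (starRingEnd ℂ)).det = conj J.det := ((starRingEnd ℂ).map_det J).symm
  rw [sesqPullback, Matrix.det_mul, Matrix.det_mul, Matrix.det_transpose, this,
    Complex.normSq_eq_conj_mul_self]
  ring

lemma traceH_eq_trace (H A : Matrix (Fin n) (Fin n) ℂ) : traceH H A = (Hᵀ * A).trace := by
  simp only [traceH, Matrix.trace, Matrix.diag, Matrix.mul_apply, Matrix.transpose_apply]
  exact Finset.sum_comm

/-- The trace of a sesquilinear form with respect to the metric is independent of coordinates. -/
lemma traceH_sesqPullback {J G A : Matrix (Fin n) (Fin n) ℂ}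
    (hdet : (sesqPullback J G).det ≠ 0) :
    traceH ((sesqPullback J G)ᵀ)⁻¹ (sesqPullback J A) = traceH (Gᵀ)⁻¹ A := by
  have h1 := hdet
  rw [det_sesqPullback] at h1
  have hJ : J.det ≠ 0 := by
    intro h; rw [h] at h1; simp at h1
  have hJ' : IsUnit (J.map (starRingEnd ℂ)).det := by
    have : (J.map (starRingEnd ℂ)).det = conj J.det := ((starRingEnd ℂ).map_det J).symm
    rw [this, isUnit_iff_ne_zero]
    simpa using hJ
  have hJt : IsUnit Jᵀ.det := by rw [Matrix.det_transpose]; exact hJ.isUnit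
  rw [traceH_eq_trace, traceH_eq_trace, Matrix.transpose_nonsing_inv, Matrix.transpose_transpose,
    Matrix.transpose_nonsing_inv, Matrix.transpose_transpose]
  simp only [sesqPullback]
  rw [Matrix.mul_inv_rev, Matrix.mul_inv_rev]
  have : (J.map (starRingEnd ℂ))⁻¹ * (G⁻¹ * (Jᵀ)⁻¹) * (Jᵀ * A * J.map (starRingEnd ℂ))
      = (J.map (starRingEnd ℂ))⁻¹ * (G⁻¹ * A * J.map (starRingEnd ℂ)) := by
    simp only [Matrix.mul_assoc]
    rw [Matrix.nonsing_inv_mul_cancel_left _ _ hJt]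
  rw [this, Matrix.trace_mul_comm, Matrix.mul_assoc, Matrix.mul_nonsing_inv _ hJ', Matrix.mul_one]

lemma traceH_sum_smul {ι : Type*} (s : Finset ι) (H : Matrix (Fin n) (Fin n) ℂ) (c : ι → ℂ)
    (A : ι → Matrix (Fin n) (Fin n) ℂ) :
    traceH H (∑ m ∈ s, c m • A m) = ∑ m ∈ s, c m * traceH H (A m) := by
  simp only [traceH_eq_trace, Finset.mul_sum, Matrix.trace_sum, Matrix.mul_smul,
    Matrix.trace_smul, smul_eq_mul]

variable {φ : CSpace n → CSpace n} {z : CSpace n}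

lemma ContDiffAt.real_of_omega {E F : Type*} [NormedAddCommGroup E] [NormedSpace ℂ E]
    [NormedAddCommGroup F] [NormedSpace ℂ F] {φ : E → F} {z : E} (hφ : ContDiffAt ℂ ω φ z) :
    ContDiffAt ℝ ∞ φ z :=
  (hφ.restrict_scalars ℝ).of_le le_top

lemma ContDiffAt.eventually_differentiableAt_complex (hφ : ContDiffAt ℂ ω φ z) :
    ∀ᶠ w in nhds z, DifferentiableAt ℂ φ w :=
  (hφ.eventually (by simp)).mono fun _ hw => hw.differentiableAt (by simp)

lemma contDiffAt_coord (hφ : ContDiffAt ℂ ω φ z) (k : Fin n) :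
    ContDiffAt ℝ ∞ (fun w => φ w k) z :=
  ContDiffAt.real_of_omega (contDiffAt_piLp _ |>.1 hφ k)

lemma jac_eq_dZ (hφ : DifferentiableAt ℂ φ z) (k i : Fin n) :
    jac φ z k i = dZ i (fun w => φ w k) z ∧ dZbar i (fun w => φ w k) z = 0 := by
  have h1 : DifferentiableAt ℂ (fun w => φ w k) z := differentiableAt_piLp _ |>.1 hφ k
  have h2 : fderiv ℝ (fun w => φ w k) z = (fderiv ℂ (fun w => φ w k) z).restrictScalars ℝ :=
    h1.fderiv_restrictScalars ℝ
  have h3 : ∀ v, fderiv ℂ (fun w => φ w k) z v = fderiv ℂ φ z v k := by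
    intro v
    have := ((EuclideanSpace.proj k : CSpace n →L[ℂ] ℂ).hasFDerivAt (x := φ z)).comp z
      hφ.hasFDerivAt
    exact congrArg (fun L : CSpace n →L[ℂ] ℂ => L v) this.fderiv
  have h4 : fderiv ℂ φ z (Complex.I • stdVec i) = Complex.I • fderiv ℂ φ z (stdVec i) :=
    map_smul _ _ _
  simp only [dZ, dZbar, h2, ContinuousLinearMap.coe_restrictScalars', h3, h4, jac, Matrix.of_apply,
    PiLp.smul_apply, smul_eq_mul]
  constructor
  · linear_combination (fderiv ℂ φ z (stdVec i) k) / 2 * Complex.I_sq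
  · linear_combination (fderiv ℂ φ z (stdVec i) k) / 2 * Complex.I_sq

lemma jac_eventuallyEq (hφ : ContDiffAt ℂ ω φ z) (k i : Fin n) :
    (fun w => jac φ w k i) =ᶠ[nhds z] dZ i (fun w => φ w k) :=
  hφ.eventually_differentiableAt_complex.mono fun _ hw => (jac_eq_dZ hw k i).1

lemma contDiffAt_jac (hφ : ContDiffAt ℂ ω φ z) (k i : Fin n) :
    ContDiffAt ℝ ∞ (fun w => jac φ w k i) z := by
  refine ContDiffAt.congr_of_eventuallyEq ?_ (jac_eventuallyEq hφ k i)
  rw [dZ_eq_wirt]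
  exact contDiffAt_wirt (contDiffAt_coord hφ k)

lemma dZ_jac_symm (hφ : ContDiffAt ℂ ω φ z) (k i j : Fin n) :
    dZ j (fun w => jac φ w k i) z = dZ i (fun w => jac φ w k j) z := by
  have h1 := jac_eventuallyEq hφ k i
  have h2 := jac_eventuallyEq hφ k j
  rw [dZ_eq_wirt] at *
  rw [wirt_congr h1, wirt_congr h2, wirt_comm (contDiffAt_coord hφ k)]

lemma dZbar_jac (hφ : ContDiffAt ℂ ω φ z) (k i j : Fin n) :
    dZbar j (fun w => jac φ w k i) z = 0 := by
  have h1 := jac_eventuallyEq hφ k i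
  have h2 : dZbar j (fun w => φ w k) =ᶠ[nhds z] fun _ => 0 :=
    hφ.eventually_differentiableAt_complex.mono fun _ hw => (jac_eq_dZ hw k j).2
  rw [dZ_eq_wirt] at h1
  rw [dZbar_eq_wirt] at h2 ⊢
  rw [wirt_congr h1, wirt_comm (contDiffAt_coord hφ k), wirt_congr h2, wirt_const]

lemma dZ_conj_jac (hφ : ContDiffAt ℂ ω φ z) (k i j : Fin n) :
    dZ j (fun w => conj (jac φ w k i)) z = 0 := by
  rw [dZ_conj, dZbar_jac hφ, map_zero]

lemma dZ_comp (hφ : ContDiffAt ℂ ω φ z) {F : CSpace n → ℂ} (hF : DifferentiableAt ℝ F (φ z))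
    (i : Fin n) : dZ i (fun w => F (φ w)) z = ∑ k, jac φ z k i * dZ k F (φ z) :=
  (wirt_comp_holomorphic (hφ.differentiableAt (by simp)) hF i).1

lemma dZbar_comp (hφ : ContDiffAt ℂ ω φ z) {F : CSpace n → ℂ} (hF : DifferentiableAt ℝ F (φ z))
    (i : Fin n) : dZbar i (fun w => F (φ w)) z = ∑ k, conj (jac φ z k i) * dZbar k F (φ z) :=
  (wirt_comp_holomorphic (hφ.differentiableAt (by simp)) hF i).2

variable {G G' : CSpace n → Matrix (Fin n) (Fin n) ℂ}

/-- `∂_c g_{a b̄} - ∂_a g_{c b̄}` transforms as a tensor: the second derivatives of the coordinate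
change cancel. -/
lemma dZ_sub_dZ_transition (hφ : ContDiffAt ℂ ω φ z)
    (hG' : ∀ a b, ContDiffAt ℝ ∞ (fun w => G' w a b) (φ z))
    (hGG' : ∀ᶠ w in nhds z, G w = sesqPullback (jac φ w) (G' (φ w))) (c a b : Fin n) :
    dZ c (fun w => G w a b) z - dZ a (fun w => G w c b) z
      = ∑ m, jac φ z m c * sesqPullback (jac φ z) (Matrix.of fun k l =>
        dZ m (fun w => G' w k l) (φ z) - dZ k (fun w => G' w m l) (φ z)) a b := by
  have hJ := fun k i => (contDiffAt_jac hφ k i).differentiableAt_infty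
  have hJc : ∀ k i, DifferentiableAt ℝ (fun w => conj (jac φ w k i)) z := fun k i =>
    Complex.conjCLE.differentiableAt.comp z (hJ k i)
  have hF : ∀ k l, DifferentiableAt ℝ (fun w => G' (φ w) k l) z := fun k l =>
    ((hG' k l).comp z hφ.real_of_omega).differentiableAt_infty
  have key : ∀ c a, dZ c (fun w => G w a b) z
      = ∑ k, ∑ l, dZ c (fun w => jac φ w k a) z * conj (jac φ z l b) * G' (φ z) k l
        + ∑ k, ∑ l, ∑ m, jac φ z m c * (jac φ z k a * conj (jac φ z l b)
          * dZ m (fun w => G' w k l) (φ z)) := by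
    intro c a
    have h1 : (fun w => G w a b) =ᶠ[nhds z]
        fun w => ∑ k, ∑ l, jac φ w k a * conj (jac φ w l b) * G' (φ w) k l :=
      hGG'.mono fun w hw => by simp only [hw, sesqPullback_apply]
    have h2 := fun k l => dZ_comp hφ (hG' k l).differentiableAt_infty c
    have h3 := fun l => dZ_conj_jac hφ l b c
    rw [dZ_eq_wirt] at *
    rw [wirt_congr h1, wirt_sum _ fun k _ => DifferentiableAt.fun_sum fun l _ =>
      ((hJ k a).fun_mul (hJc l b)).fun_mul (hF k l), ← Finset.sum_add_distrib]
    refine Finset.sum_congr rfl fun k _ => ?_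
    rw [wirt_sum _ fun l _ => ((hJ k a).fun_mul (hJc l b)).fun_mul (hF k l),
      ← Finset.sum_add_distrib]
    refine Finset.sum_congr rfl fun l _ => ?_
    rw [wirt_mul ((hJ k a).fun_mul (hJc l b)) (hF k l), wirt_mul (hJ k a) (hJc l b), h2, h3,
      Finset.mul_sum]
    simp only [mul_zero, add_zero]
    congr 1
    exact Finset.sum_congr rfl fun m _ => by ring
  have hsymm : ∀ k l, dZ c (fun w => jac φ w k a) z * conj (jac φ z l b) * G' (φ z) k l
      = dZ a (fun w => jac φ w k c) z * conj (jac φ z l b) * G' (φ z) k l := fun k l => by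
    rw [dZ_jac_symm hφ]
  rw [key c a, key a c]
  simp only [hsymm, add_sub_add_left_eq_sub, sesqPullback_apply, Matrix.of_apply, mul_sub,
    Finset.mul_sum, Finset.sum_sub_distrib]
  congr 1
  · rw [Finset.sum_congr rfl fun k _ => Finset.sum_comm, Finset.sum_comm]
  · rw [Finset.sum_congr rfl fun k _ => Finset.sum_comm]
    exact Finset.sum_congr rfl fun k _ => Finset.sum_congr rfl fun l _ =>
      Finset.sum_congr rfl fun m _ => by ring

/-- `η` transforms as a `(1,0)`-form. -/
lemma torsionTrace_transition (hφ : ContDiffAt ℂ ω φ z)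
    (hG' : ∀ a b, ContDiffAt ℝ ∞ (fun w => G' w a b) (φ z)) (hdet : (G z).det ≠ 0)
    (hGG' : ∀ᶠ w in nhds z, G w = sesqPullback (jac φ w) (G' (φ w))) (c : Fin n) :
    torsionTrace G c z = ∑ m, jac φ z m c * torsionTrace G' m (φ z) := by
  have h1 : (Matrix.of fun a b => dZ c (fun w => G w a b) z - dZ a (fun w => G w c b) z)
      = ∑ m, jac φ z m c • sesqPullback (jac φ z) (Matrix.of fun k l =>
        dZ m (fun w => G' w k l) (φ z) - dZ k (fun w => G' w m l) (φ z)) := by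
    ext a b
    rw [Matrix.of_apply, dZ_sub_dZ_transition hφ hG' hGG', Matrix.sum_apply]
    rfl
  have h2 : torsionTrace G c z = traceH (metricInv G z)
      (Matrix.of fun a b => dZ c (fun w => G w a b) z - dZ a (fun w => G w c b) z) := rfl
  have h3 := hGG'.self_of_nhds
  rw [h2, h1, traceH_sum_smul]
  refine Finset.sum_congr rfl fun m _ => ?_
  congr 1
  rw [metricInv, h3, traceH_sesqPullback (h3 ▸ hdet)]
  rfl

/-- On the open set `U`, the coordinate change `φ` is holomorphic and pulls the metric with
coefficients `G'` back to the metric with coefficients `G`. -/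
structure IsMetricChange (φ : CSpace n → CSpace n) (G G' : CSpace n → Matrix (Fin n) (Fin n) ℂ)
    (U : Set (CSpace n)) : Prop where
  isOpen : IsOpen U
  holo : ∀ w ∈ U, ContDiffAt ℂ ω φ w
  smooth_right : ∀ w ∈ U, ∀ a b, ContDiffAt ℝ ∞ (fun w => G' w a b) (φ w)
  det_left : ∀ w ∈ U, (G w).det ≠ 0
  pullback : ∀ w ∈ U, G w = sesqPullback (jac φ w) (G' (φ w))

namespace IsMetricChange

variable {U : Set (CSpace n)}

lemma det_right (h : IsMetricChange φ G G' U) (hz : z ∈ U) : (G' (φ z)).det ≠ 0 := by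
  have h1 := h.det_left z hz
  rw [h.pullback z hz, det_sesqPullback] at h1
  exact right_ne_zero_of_mul h1

lemma torsionTrace_eq (h : IsMetricChange φ G G' U) (hz : z ∈ U) (c : Fin n) :
    torsionTrace G c z = ∑ m, jac φ z m c * torsionTrace G' m (φ z) :=
  torsionTrace_transition (h.holo z hz) (h.smooth_right z hz) (h.det_left z hz)
    (Filter.mem_of_superset (h.isOpen.mem_nhds hz) h.pullback) c

lemma traceH_eq (h : IsMetricChange φ G G' U) (hz : z ∈ U) {A A' : Matrix (Fin n) (Fin n) ℂ}
    (hA : A = sesqPullback (jac φ z) A') :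
    traceH (metricInv G z) A = traceH (metricInv G' (φ z)) A' := by
  have h1 := h.det_left z hz
  rw [h.pullback z hz] at h1
  rw [metricInv, h.pullback z hz, hA, traceH_sesqPullback h1]
  rfl

/-- The Jacobian matrix is holomorphic, so `∂̄η` is a tensor. -/
lemma traceH_dZbar_torsionTrace (h : IsMetricChange φ G G' U) (hz : z ∈ U) :
    traceH (metricInv G z) (Matrix.of fun i j => dZbar j (torsionTrace G i) z)
      = traceH (metricInv G' (φ z)) (Matrix.of fun i j => dZbar j (torsionTrace G' i) (φ z)) := by
  refine h.traceH_eq hz ?_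
  ext c d
  have h1 : torsionTrace G c =ᶠ[nhds z] fun w => ∑ m, jac φ w m c * torsionTrace G' m (φ w) :=
    Filter.mem_of_superset (h.isOpen.mem_nhds hz) fun w hw => h.torsionTrace_eq hw c
  have hη : ∀ m, ContDiffAt ℝ ∞ (torsionTrace G' m) (φ z) := fun m =>
    contDiffAt_torsionTrace (h.smooth_right z hz) (h.det_right hz) m
  have h2 := fun m => dZbar_comp (h.holo z hz) (hη m).differentiableAt_infty d
  have h3 := fun m => dZbar_jac (h.holo z hz) m c d
  have hJ := fun m => (contDiffAt_jac (h.holo z hz) m c).differentiableAt_infty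
  have hF : ∀ m, DifferentiableAt ℝ (fun w => torsionTrace G' m (φ w)) z := fun m =>
    ((hη m).comp z (h.holo z hz).real_of_omega).differentiableAt_infty
  rw [dZbar_eq_wirt] at *
  rw [Matrix.of_apply, wirt_congr h1, wirt_sum _ fun m _ => (hJ m).fun_mul (hF m),
    sesqPullback_apply]
  simp only [Matrix.of_apply]
  refine Finset.sum_congr rfl fun m _ => ?_
  rw [wirt_mul (hJ m) (hF m), h3, h2, zero_mul, zero_add, Finset.mul_sum]
  exact Finset.sum_congr rfl fun l _ => by ring

lemma traceH_torsionTrace_dZbar (h : IsMetricChange φ G G' U) (hz : z ∈ U)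
    {f f' : CSpace n → ℂ} (hf' : DifferentiableAt ℝ f' (φ z)) (hff' : ∀ w ∈ U, f w = f' (φ w)) :
    traceH (metricInv G z) (Matrix.of fun i j => torsionTrace G i z * dZbar j f z)
      = traceH (metricInv G' (φ z))
        (Matrix.of fun i j => torsionTrace G' i (φ z) * dZbar j f' (φ z)) := by
  refine h.traceH_eq hz ?_
  ext c d
  have h1 : f =ᶠ[nhds z] fun w => f' (φ w) :=
    Filter.mem_of_superset (h.isOpen.mem_nhds hz) hff'
  have h2 : dZbar d f z = ∑ k, conj (jac φ z k d) * dZbar k f' (φ z) := by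
    rw [← dZbar_comp (h.holo z hz) hf' d, dZbar_eq_wirt, wirt_congr h1]
  rw [sesqPullback_apply, Matrix.of_apply, h.torsionTrace_eq hz, h2, Finset.sum_mul_sum]
  simp only [Matrix.of_apply]
  exact Finset.sum_congr rfl fun m _ => Finset.sum_congr rfl fun l _ => by ring

end IsMetricChange

end Transition

/-! ### Metric coefficients in holomorphic charts -/

namespace HermitianMetric

variable {n : ℕ} {M : Type*} [TopologicalSpace M] [ChartedSpace (CSpace n) M]
  (g : HermitianMetric n M)

/-- The matrix `(g_{i j̄})` of the metric in the chart `e`. -/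
noncomputable def coeffMatrix (e : OpenPartialHomeomorph M (CSpace n)) (z : CSpace n) :
    Matrix (Fin n) (Fin n) ℂ :=
  Matrix.of fun a b => g.coeff e a b z

lemma invCoeff_eq (e : OpenPartialHomeomorph M (CSpace n)) (z : CSpace n) (i j : Fin n) :
    g.invCoeff e z i j = metricInv (g.coeffMatrix e) z i j := rfl

lemma sum_torsion_eq (e : OpenPartialHomeomorph M (CSpace n)) (z : CSpace n) (i : Fin n) :
    ∑ k, g.torsion e z i k k = torsionTrace (g.coeffMatrix e) i z := rfl

/-- All tangent spaces are the same type, so that a coordinate vector may be read at equal points. -/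
lemma form_congr {p q : M} (h : p = q) (X Y : CSpace n) :
    g.form p (X : TangentSpace 𝓘(ℂ, CSpace n) p) (Y : TangentSpace 𝓘(ℂ, CSpace n) p)
      = g.form q (X : TangentSpace 𝓘(ℂ, CSpace n) q) (Y : TangentSpace 𝓘(ℂ, CSpace n) q) := by
  subst h; rfl

lemma eq_sum_smul_stdVec (ξ : CSpace n) : ξ = ∑ i, ξ i • stdVec i := by
  ext k
  simp only [WithLp.ofLp_sum, Finset.sum_apply, WithLp.ofLp_smul, Pi.smul_apply, stdVec,
    EuclideanSpace.single]
  rw [Finset.sum_eq_single k]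
  · simp
  · intro b _ hb; simp [Ne.symm hb]
  · simp

lemma form_sum_sum (p : M) (X Y : Fin n → TangentSpace 𝓘(ℂ, CSpace n) p) (ξ ζ : Fin n → ℂ) :
    g.form p (∑ i, ξ i • X i) (∑ j, ζ j • Y j)
      = ∑ i, ∑ j, ξ i * conj (ζ j) * g.form p (X i) (Y j) := by
  rw [map_sum (g.form p), LinearMap.sum_apply]
  refine Finset.sum_congr rfl fun i _ => ?_
  rw [map_sum]
  refine Finset.sum_congr rfl fun j _ => ?_
  rw [map_smulₛₗ (g.form p (ξ i • X i)), map_smul (g.form p), LinearMap.smul_apply, smul_eq_mul,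
    smul_eq_mul]
  ring

lemma form_mfderiv_symm (e : OpenPartialHomeomorph M (CSpace n)) (z : CSpace n) (ξ ζ : CSpace n) :
    g.form (e.symm z) (mfderiv 𝓘(ℂ, CSpace n) 𝓘(ℂ, CSpace n) e.symm z ξ)
      (mfderiv 𝓘(ℂ, CSpace n) 𝓘(ℂ, CSpace n) e.symm z ζ)
      = ∑ i, ∑ j, ξ i * conj (ζ j) * g.coeffMatrix e z i j := by
  have h : ∀ ξ : CSpace n, mfderiv 𝓘(ℂ, CSpace n) 𝓘(ℂ, CSpace n) e.symm z ξ
      = ∑ i, ξ i • coordVec e z i := by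
    intro ξ
    conv_lhs => rw [eq_sum_smul_stdVec ξ]
    simp only [coordVec]
    erw [map_sum]
    exact Finset.sum_congr rfl fun i _ => map_smul _ _ _
  rw [h, h, form_sum_sum]
  rfl

variable {e e' : OpenPartialHomeomorph M (CSpace n)} {z : CSpace n}

lemma mfderiv_symm_injective (he : e ∈ IsManifold.maximalAtlas 𝓘(ℂ, CSpace n) ω M)
    (hz : z ∈ e.target) :
    Function.Injective (mfderiv 𝓘(ℂ, CSpace n) 𝓘(ℂ, CSpace n) e.symm z) := by
  have hd : e.MDifferentiable 𝓘(ℂ, CSpace n) 𝓘(ℂ, CSpace n) :=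
    ⟨(contMDiffOn_of_mem_maximalAtlas he).mdifferentiableOn (by simp),
      (contMDiffOn_symm_of_mem_maximalAtlas he).mdifferentiableOn (by simp)⟩
  exact hd.symm.mfderiv_injective hz

lemma contDiffAt_coeffMatrix (he : e ∈ IsManifold.maximalAtlas 𝓘(ℂ, CSpace n) ω M)
    (hz : z ∈ e.target) (a b : Fin n) :
    ContDiffAt ℝ ∞ (fun w => g.coeffMatrix e w a b) z :=
  (g.smooth e he a b).contDiffAt (e.open_target.mem_nhds hz)

lemma isHermitian_coeffMatrix (e : OpenPartialHomeomorph M (CSpace n)) (z : CSpace n) :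
    (g.coeffMatrix e z).IsHermitian := by
  ext a b
  exact g.conj_symm _ _ _

lemma posDef_coeffMatrix (he : e ∈ IsManifold.maximalAtlas 𝓘(ℂ, CSpace n) ω M)
    (hz : z ∈ e.target) : (g.coeffMatrix e z).PosDef := by
  refine Matrix.PosDef.of_dotProduct_mulVec_pos (g.isHermitian_coeffMatrix e z) fun x hx => ?_
  set ξ : CSpace n := WithLp.toLp 2 (star x) with hξ
  have hξ0 : ξ ≠ 0 := by
    intro h
    apply hx
    have : star x = 0 := congrArg WithLp.ofLp h
    simpa using this
  have h1 := g.form_mfderiv_symm e z ξ ξ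
  have h2 : star x ⬝ᵥ (g.coeffMatrix e z).mulVec x
      = ∑ i, ∑ j, ξ i * conj (ξ j) * g.coeffMatrix e z i j := by
    simp only [dotProduct, Matrix.mulVec, Finset.mul_sum]
    refine Finset.sum_congr rfl fun i _ => Finset.sum_congr rfl fun j _ => ?_
    simp [hξ]; ring
  have hne : mfderiv 𝓘(ℂ, CSpace n) 𝓘(ℂ, CSpace n) e.symm z ξ ≠ 0 := by
    intro h
    exact hξ0 (mfderiv_symm_injective he hz (h.trans (map_zero _).symm))
  rw [h2, ← h1, Complex.pos_iff]
  refine ⟨g.pos_def _ _ hne, ?_⟩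
  have h3 := g.conj_symm _ (mfderiv 𝓘(ℂ, CSpace n) 𝓘(ℂ, CSpace n) e.symm z ξ)
    (mfderiv 𝓘(ℂ, CSpace n) 𝓘(ℂ, CSpace n) e.symm z ξ)
  exact (Complex.conj_eq_iff_im.1 h3).symm

/-- The coordinate change between two holomorphic charts. -/
lemma isMetricChange [IsManifold 𝓘(ℂ, CSpace n) ω M]
    (he : e ∈ IsManifold.maximalAtlas 𝓘(ℂ, CSpace n) ω M)
    (he' : e' ∈ IsManifold.maximalAtlas 𝓘(ℂ, CSpace n) ω M) :
    IsMetricChange (e' ∘ e.symm) (g.coeffMatrix e) (g.coeffMatrix e')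
      (e.symm.trans e').source := by
  have hholo : ContDiffOn ℂ ω (e' ∘ e.symm) (e.symm.trans e').source := by
    have := IsManifold.compatible_of_mem_maximalAtlas he he'
    rw [contDiffGroupoid, mem_groupoid_of_pregroupoid] at this
    simpa [contDiffPregroupoid] using this.1
  have hsrc : ∀ w ∈ (e.symm.trans e').source, w ∈ e.target ∧ e.symm w ∈ e'.source := by
    intro w hw; simpa using hw
  refine ⟨(e.symm.trans e').open_source, fun w hw =>
    hholo.contDiffAt ((e.symm.trans e').open_source.mem_nhds hw), fun w hw a b =>
    g.contDiffAt_coeffMatrix he' (e'.map_source (hsrc w hw).2) a b, fun w hw =>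
    (g.posDef_coeffMatrix he (hsrc w hw).1).det_pos.ne', fun w hw => ?_⟩
  obtain ⟨hw1, hw2⟩ := hsrc w hw
  have hφ : DifferentiableAt ℂ (e' ∘ e.symm) w :=
    (hholo.contDiffAt ((e.symm.trans e').open_source.mem_nhds hw)).differentiableAt (by simp)
  have h1 : (e.symm : CSpace n → M) =ᶠ[nhds w] e'.symm ∘ (e' ∘ e.symm) := by
    filter_upwards [(e.symm.trans e').open_source.mem_nhds hw] with x hx
    exact (e'.left_inv (hsrc x hx).2).symm
  have hpt : e.symm w = e'.symm ((e' ∘ e.symm) w) := h1.self_of_nhds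
  have h2 : ∀ v : CSpace n, (mfderiv 𝓘(ℂ, CSpace n) 𝓘(ℂ, CSpace n) e.symm w v : CSpace n)
      = mfderiv 𝓘(ℂ, CSpace n) 𝓘(ℂ, CSpace n) e'.symm ((e' ∘ e.symm) w)
        (fderiv ℂ (e' ∘ e.symm) w v) := by
    intro v
    have h3 := h1.mfderiv_eq (I := 𝓘(ℂ, CSpace n)) (I' := 𝓘(ℂ, CSpace n))
    have h4 := mfderiv_comp (I := 𝓘(ℂ, CSpace n)) (I' := 𝓘(ℂ, CSpace n))
      (I'' := 𝓘(ℂ, CSpace n)) w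
      ((contMDiffAt_symm_of_mem_maximalAtlas he' (e'.map_source hw2)).mdifferentiableAt (by simp))
      hφ.mdifferentiableAt
    rw [mfderiv_eq_fderiv] at h4
    exact congrArg (fun L : CSpace n →L[ℂ] CSpace n => L v) (h3.trans h4)
  ext a b
  have h5 := g.form_congr hpt (mfderiv 𝓘(ℂ, CSpace n) 𝓘(ℂ, CSpace n) e.symm w (stdVec a))
    (mfderiv 𝓘(ℂ, CSpace n) 𝓘(ℂ, CSpace n) e.symm w (stdVec b))
  rw [h2, h2] at h5
  rw [sesqPullback_apply]
  refine Eq.trans ?_ (h5.trans (g.form_mfderiv_symm e' _ _ _))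
  rw [← h2, ← h2]
  rfl

end HermitianMetric

/-! ### Consequences of the curvature condition -/

namespace HermitianMetric

variable {n : ℕ} {M : Type*} [TopologicalSpace M] [ChartedSpace (CSpace n) M]
  (g : HermitianMetric n M)

/-- Every coordinate vector is realized by a tangent vector at `p`. -/
lemma exists_coordForm_eq [IsManifold 𝓘(ℂ, CSpace n) ω M] (p : M) (ξ : CSpace n) :
    ∃ X : TangentSpace 𝓘(ℂ, CSpace n) p,
      (∀ i, coordForm (chartAt (CSpace n) p) p i X = ξ i) ∧
      g.form p X X = ∑ i, ∑ j, g.coeffMatrix (chartAt (CSpace n) p) (chartAt (CSpace n) p p) i j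
        * (ξ i * conj (ξ j)) := by
  set e := chartAt (CSpace n) p with he
  have hp : p ∈ e.source := mem_chart_source _ p
  have hpt : e.symm (e p) = p := e.left_inv hp
  have hd : e.MDifferentiable 𝓘(ℂ, CSpace n) 𝓘(ℂ, CSpace n) := by
    have hmem : e ∈ IsManifold.maximalAtlas 𝓘(ℂ, CSpace n) ω M := IsManifold.chart_mem_maximalAtlas p
    exact ⟨(contMDiffOn_of_mem_maximalAtlas hmem).mdifferentiableOn (by simp),
      (contMDiffOn_symm_of_mem_maximalAtlas hmem).mdifferentiableOn (by simp)⟩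
  refine ⟨(mfderiv 𝓘(ℂ, CSpace n) 𝓘(ℂ, CSpace n) e.symm (e p) ξ : CSpace n), fun i => ?_, ?_⟩
  · have h1 := hd.comp_symm_deriv (e.map_source hp)
    have h2 : ∀ q : M, q = p → ∀ v : CSpace n,
        (mfderiv 𝓘(ℂ, CSpace n) 𝓘(ℂ, CSpace n) e p v : CSpace n)
          = (mfderiv 𝓘(ℂ, CSpace n) 𝓘(ℂ, CSpace n) e q v : CSpace n) := by
      rintro q rfl v; rfl
    have h3 : (mfderiv 𝓘(ℂ, CSpace n) 𝓘(ℂ, CSpace n) e p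
        (mfderiv 𝓘(ℂ, CSpace n) 𝓘(ℂ, CSpace n) e.symm (e p) ξ : CSpace n) : CSpace n) = ξ := by
      exact (h2 _ hpt _).trans (congrArg (fun L : CSpace n →L[ℂ] CSpace n => L ξ) h1)
    exact congrArg (fun v : CSpace n => v i) h3
  · refine (g.form_congr hpt _ _).symm.trans ((g.form_mfderiv_symm e (e p) ξ ξ).trans ?_)
    exact Finset.sum_congr rfl fun i _ => Finset.sum_congr rfl fun j _ => mul_comm _ _

/-- The traces of the four Ricci curvatures: the first two give the Chern scalar curvature, the
last two the altered one. -/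
lemma traceH_chernRicci (k : RicciKind) (e : OpenPartialHomeomorph M (CSpace n)) (z : CSpace n) :
    traceH (metricInv (g.coeffMatrix e) z) (Matrix.of (g.chernRicci e z k))
      = match k with
        | .first | .second => ∑ i, ∑ j, ∑ k, ∑ l, metricInv (g.coeffMatrix e) z i j
            * metricInv (g.coeffMatrix e) z k l * g.chernCurv e z i j k l
        | .third | .fourth => ∑ i, ∑ j, ∑ k, ∑ l, metricInv (g.coeffMatrix e) z i l
            * metricInv (g.coeffMatrix e) z k j * g.chernCurv e z i j k l := by
  have c1 : ∀ F : Fin n → Fin n → Fin n → ℂ,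
      ∑ j, ∑ k, ∑ l, F j k l = ∑ k, ∑ l, ∑ j, F j k l := by
    intro F
    rw [Finset.sum_comm]
    exact Finset.sum_congr rfl fun k _ => Finset.sum_comm
  cases k <;> simp only [traceH, Matrix.of_apply, chernRicci, Finset.mul_sum, invCoeff_eq]
  · simp only [mul_assoc]
  · rw [Finset.sum_congr rfl fun a _ => c1 _, c1]
    exact Finset.sum_congr rfl fun k _ => Finset.sum_congr rfl fun a _ =>
      Finset.sum_congr rfl fun b _ => Finset.sum_congr rfl fun c _ => by ring
  · refine Finset.sum_congr rfl fun a _ => ?_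
    rw [c1, Finset.sum_comm]
    exact Finset.sum_congr rfl fun k _ => Finset.sum_congr rfl fun a _ =>
      Finset.sum_congr rfl fun b _ => by ring
  · rw [Finset.sum_congr rfl fun a _ => Finset.sum_comm, Finset.sum_comm]
    refine Finset.sum_congr rfl fun i _ => ?_
    rw [Finset.sum_comm]
    exact Finset.sum_congr rfl fun j _ => Finset.sum_congr rfl fun k _ =>
      Finset.sum_congr rfl fun l _ => by ring

lemma chernScalar_eq (p : M) : g.chernScalar p
    = traceH (metricInv (g.coeffMatrix (chartAt (CSpace n) p)) (chartAt (CSpace n) p p))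
      (Matrix.of (g.chernRicci (chartAt (CSpace n) p) (chartAt (CSpace n) p p) .first)) := rfl

lemma alteredChernScalar_eq (p : M) : g.alteredChernScalar p
    = traceH (metricInv (g.coeffMatrix (chartAt (CSpace n) p)) (chartAt (CSpace n) p p))
      (Matrix.of (g.chernRicci (chartAt (CSpace n) p) (chartAt (CSpace n) p p) .third)) := rfl

/-- Tracing the vanishing of the mixed curvature gives `α (n + 1) tr Ric⁽ᵏ⁾ + β (u + v) = 0`, where
`tr Ric⁽ᵏ⁾` is `u` or `v`; under the relation between `α` and `β` both cases give `u = v`. -/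
lemma chernScalar_eq_alteredChernScalar [IsManifold 𝓘(ℂ, CSpace n) ω M]
    (k : RicciKind) (α β : ℝ) (hβ : β ≠ 0) (hαβ : α * (n + 1) + 2 * β = 0) (p : M)
    (hC : ∀ X : TangentSpace 𝓘(ℂ, CSpace n) p, X ≠ 0 → g.mixedCurv k α β p X = 0) :
    g.chernScalar p = g.alteredChernScalar p := by
  set e := chartAt (CSpace n) p with he
  have hp : p ∈ e.source := mem_chart_source _ p
  have hmem : e ∈ IsManifold.maximalAtlas 𝓘(ℂ, CSpace n) ω M := IsManifold.chart_mem_maximalAtlas p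
  have hpos := g.posDef_coeffMatrix hmem (e.map_source hp)
  have key := trace_mixed_curvature hpos (g.chernCurv e (e p)) (g.chernRicci e (e p) k) α β ?_
  · have hu := g.traceH_chernRicci .first e (e p)
    have hv := g.traceH_chernRicci .third e (e p)
    rw [g.chernScalar_eq, g.alteredChernScalar_eq, ← he, hu, hv]
    have hk := g.traceH_chernRicci k e (e p)
    have hαβ' : (α : ℂ) * (n + 1) + 2 * β = 0 := by exact_mod_cast hαβ
    have hβ' : (β : ℂ) ≠ 0 := by exact_mod_cast hβ
    change (α : ℂ) * (n + 1) * traceH (metricInv (g.coeffMatrix e) (e p)) _ + β * (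
      (∑ i, ∑ j, ∑ k, ∑ l, metricInv (g.coeffMatrix e) (e p) i j
        * metricInv (g.coeffMatrix e) (e p) k l * g.chernCurv e (e p) i j k l)
      + ∑ i, ∑ j, ∑ k, ∑ l, metricInv (g.coeffMatrix e) (e p) i l
        * metricInv (g.coeffMatrix e) (e p) k j * g.chernCurv e (e p) i j k l) = 0 at key
    rw [hk] at key
    have h1 : ∀ U V : ℂ, (α : ℂ) * (n + 1) * U + β * (U + V) = 0 → U = V := fun U V h =>
      mul_left_cancel₀ hβ' (by linear_combination -h + hαβ' * U)
    have h2 : ∀ U V : ℂ, (α : ℂ) * (n + 1) * V + β * (U + V) = 0 → U = V := fun U V h =>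
      mul_left_cancel₀ hβ' (by linear_combination h - hαβ' * V)
    cases k
    · exact h1 _ _ key
    · exact h1 _ _ key
    · exact h2 _ _ key
    · exact h2 _ _ key
  · intro ξ
    obtain ⟨X, hX, hform⟩ := g.exists_coordForm_eq p (WithLp.toLp 2 ξ)
    rw [← he] at hX hform
    by_cases hX0 : X = 0
    · have hξ : ∀ i, ξ i = 0 := by
        intro i; have := hX i; rw [hX0, map_zero] at this; exact this.symm
      simp [hξ]
    · have h1 := hC X hX0
      have him : (g.form p X X).im = 0 := Complex.conj_eq_iff_im.1 (g.conj_symm p X X)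
      have h2 : (g.normSq p X : ℂ) = g.form p X X := Complex.ext rfl (by simp [him])
      have h3 : g.form p X X ≠ 0 := by
        intro h; have := g.pos_def p X hX0; rw [h] at this; simp at this
      have h4 : g.ricciDiag k p X
          = ∑ a, ∑ b, g.chernRicci e (e p) k a b * (ξ a * conj (ξ b)) := by
        simp only [ricciDiag, ← he, hX]
      have h5 : g.curvDiag p X = ∑ i, ∑ j, ∑ k, ∑ l, g.chernCurv e (e p) i j k l *
          (ξ i * conj (ξ j) * ξ k * conj (ξ l)) := by
        simp only [curvDiag, ← he, hX]
      rw [mixedCurv, holSectCurv, h2, h4, h5] at h1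
      have h6 : g.form p X X = ∑ i, ∑ j, g.coeffMatrix e (e p) i j * (ξ i * conj (ξ j)) := hform
      rw [← h6]
      generalize ∑ a, ∑ b, g.chernRicci e (e p) k a b * (ξ a * conj (ξ b)) = r at h1 ⊢
      generalize ∑ i, ∑ j, ∑ k, ∑ l, g.chernCurv e (e p) i j k l *
        (ξ i * conj (ξ j) * ξ k * conj (ξ l)) = q at h1 ⊢
      field_simp at h1
      linear_combination h1

/-- When `u = v`, the trace of `∂̄η` vanishes. -/
lemma traceH_dZbar_torsionTrace_eq_zero [IsManifold 𝓘(ℂ, CSpace n) ω M]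
    (huv : ∀ p, g.chernScalar p = g.alteredChernScalar p)
    {e : OpenPartialHomeomorph M (CSpace n)}
    (he : e ∈ IsManifold.maximalAtlas 𝓘(ℂ, CSpace n) ω M) {z : CSpace n} (hz : z ∈ e.target) :
    traceH (metricInv (g.coeffMatrix e) z)
      (Matrix.of fun i j => dZbar j (torsionTrace (g.coeffMatrix e) i) z) = 0 := by
  set p := e.symm z with hp
  set e' := chartAt (CSpace n) p with he'
  have hp' : p ∈ e'.source := mem_chart_source _ p
  have hmem : e' ∈ IsManifold.maximalAtlas 𝓘(ℂ, CSpace n) ω M :=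
    IsManifold.chart_mem_maximalAtlas p
  have hzU : z ∈ (e.symm.trans e').source := by
    simp only [OpenPartialHomeomorph.trans_source, OpenPartialHomeomorph.symm_source]
    exact ⟨hz, hp'⟩
  rw [(g.isMetricChange he hmem).traceH_dZbar_torsionTrace hzU]
  have h1 := scalar_sub_alteredScalar (fun a b => g.contDiffAt_coeffMatrix hmem
    (e'.map_source hp') a b) (g.posDef_coeffMatrix hmem (e'.map_source hp')).det_pos.ne'
  have h2 := sub_eq_zero.2 (huv p)
  have h3 := h1.symm.trans h2
  exact neg_eq_zero.1 h3

end HermitianMetric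

/-! ### Integration on open subsets of `ℂⁿ` -/

section Integration

open MeasureTheory Set

variable {n : ℕ}

lemma integral_wirt_eq_zero (μ : Measure (CSpace n)) [μ.IsAddHaarMeasure] {F : CSpace n → ℂ}
    (hF : ContDiff ℝ ∞ F) (hc : HasCompactSupport F) (c : ℂ) (i : Fin n) :
    ∫ z, wirt c i F z ∂μ = 0 := by
  have hd : Differentiable ℝ F := hF.differentiable (by simp)
  have hcont : ∀ v, Continuous fun z => fderiv ℝ F z v := fun v =>
    (hF.continuous_fderiv (by simp)).clm_apply continuous_const
  have hint : ∀ v, Integrable (fun z => fderiv ℝ F z v) μ := fun v =>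
    (hcont v).integrable_of_hasCompactSupport (hc.fderiv_apply (𝕜 := ℝ) v)
  have hzero : ∀ v, ∫ z, fderiv ℝ F z v ∂μ = 0 := by
    intro v
    have h := integral_mul_fderiv_eq_neg_fderiv_mul_of_integrable (μ := μ)
      (f := fun _ : CSpace n => (1 : ℂ)) (g := F) (v := v) (by simp)
      (by simpa using hint v)
      (by simpa using hF.continuous.integrable_of_hasCompactSupport hc)
      (fun x _ => differentiableAt_const _) (fun x _ => hd x)
    simpa using h
  simp only [wirt]
  rw [integral_div, integral_add (hint _) ((hint _).const_mul c), integral_const_mul, hzero, hzero]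
  simp

/-- The integral of a divergence of a vector field that is supported in a compact subset of an
open set vanishes. -/
lemma setIntegral_divergence_eq_zero (μ : Measure (CSpace n)) [μ.IsAddHaarMeasure]
    {U K : Set (CSpace n)} (hU : IsOpen U) (hK : IsCompact K) (hKU : K ⊆ U)
    {F : Fin n → CSpace n → ℂ} (hF : ∀ s, ∀ z ∈ U, ContDiffAt ℝ ∞ (F s) z)
    (hF0 : ∀ s, ∀ z ∈ U, z ∉ K → F s z = 0) :
    ∫ z in U, ∑ s, dZbar s (F s) z ∂μ = 0 := by
  have hev : ∀ s, ∀ z ∈ U, U.indicator (F s) =ᶠ[nhds z] F s := fun s z hz =>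
    Filter.mem_of_superset (hU.mem_nhds hz) fun w hw => indicator_of_mem hw _
  have hsupp : ∀ s, ∀ z ∉ K, U.indicator (F s) z = 0 := by
    intro s z hz
    by_cases h : z ∈ U
    · rw [indicator_of_mem h, hF0 s z h hz]
    · exact indicator_of_notMem h _
  have hev0 : ∀ s, ∀ z ∉ K, U.indicator (F s) =ᶠ[nhds z] fun _ => 0 := fun s z hz =>
    Filter.mem_of_superset (hK.isClosed.isOpen_compl.mem_nhds hz) fun w hw => hsupp s w hw
  have hsm : ∀ s, ContDiff ℝ ∞ (U.indicator (F s)) := by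
    intro s
    rw [contDiff_iff_contDiffAt]
    intro z
    by_cases hz : z ∈ K
    · exact (hF s z (hKU hz)).congr_of_eventuallyEq (hev s z (hKU hz))
    · exact contDiffAt_const.congr_of_eventuallyEq (hev0 s z hz)
  have hc : ∀ s, HasCompactSupport (U.indicator (F s)) := fun s =>
    HasCompactSupport.intro hK (hsupp s)
  have h1 : ∀ z, U.indicator (fun z => ∑ s, dZbar s (F s) z) z
      = ∑ s, wirt Complex.I s (U.indicator (F s)) z := by
    intro z
    rw [dZbar_eq_wirt]
    by_cases hz : z ∈ U
    · rw [indicator_of_mem hz]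
      exact Finset.sum_congr rfl fun s _ => (wirt_congr (hev s z hz)).symm
    · rw [indicator_of_notMem hz]
      refine (Finset.sum_eq_zero fun s _ => ?_).symm
      rw [wirt_congr (hev0 s z fun h => hz (hKU h)), wirt_const]
  have hint : ∀ s, Integrable (fun z => wirt Complex.I s (U.indicator (F s)) z) μ := by
    intro s
    have hcont : ∀ v, Continuous fun z => fderiv ℝ (U.indicator (F s)) z v := fun v =>
      ((hsm s).continuous_fderiv (by simp)).clm_apply continuous_const
    have hi : ∀ v, Integrable (fun z => fderiv ℝ (U.indicator (F s)) z v) μ := fun v =>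
      (hcont v).integrable_of_hasCompactSupport ((hc s).fderiv_apply (𝕜 := ℝ) v)
    exact ((hi _).add ((hi _).const_mul _)).div_const 2
  rw [← integral_indicator hU.measurableSet]
  simp only [h1]
  rw [integral_finsetSum _ fun s _ => hint s]
  exact Finset.sum_eq_zero fun s _ => integral_wirt_eq_zero μ (hsm s) (hc s) _ _

lemma integrableOn_of_compact (μ : Measure (CSpace n)) [μ.IsAddHaarMeasure]
    {U K : Set (CSpace n)} (hU : IsOpen U) (hK : IsCompact K) (hKU : K ⊆ U)
    {F : CSpace n → ℂ} (hF : ContinuousOn F U) (hF0 : ∀ z ∈ U, z ∉ K → F z = 0) :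
    IntegrableOn F U μ :=
  ((hF.mono hKU).integrableOn_compact hK).of_forall_sdiff_eq_zero hU.measurableSet
    fun z hz => hF0 z hz.1 hz.2

lemma det_fderiv_eq {φ : CSpace n → CSpace n} (z : CSpace n) :
    ((fderiv ℂ φ z).restrictScalars ℝ).det = Complex.normSq (jac φ z).det := by
  have h1 : ((fderiv ℂ φ z).restrictScalars ℝ).det
      = LinearMap.det ((fderiv ℂ φ z : CSpace n →ₗ[ℂ] CSpace n).restrictScalars ℝ) := rfl
  have h2 : LinearMap.det (fderiv ℂ φ z : CSpace n →ₗ[ℂ] CSpace n) = (jac φ z).det := by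
    rw [← LinearMap.det_toMatrix (EuclideanSpace.basisFun (Fin n) ℂ).toBasis]
    congr 1
  rw [h1, LinearMap.det_restrictScalars, h2, Algebra.norm_complex_eq]
  rfl

/-- Change of variables: the volume form `det g` is independent of coordinates. -/
lemma IsMetricChange.setIntegral_eq (μ : Measure (CSpace n)) [μ.IsAddHaarMeasure]
    {φ : CSpace n → CSpace n} {G G' : CSpace n → Matrix (Fin n) (Fin n) ℂ} {U : Set (CSpace n)}
    (h : IsMetricChange φ G G' U) (hinj : InjOn φ U) {f f' : CSpace n → ℂ}
    (hf : ∀ z ∈ U, f z = f' (φ z)) :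
    ∫ z in U, (G z).det * f z ∂μ = ∫ z in φ '' U, (G' z).det * f' z ∂μ := by
  rw [integral_image_eq_integral_abs_det_fderiv_smul μ h.isOpen.measurableSet
    (f' := fun z => (fderiv ℂ φ z).restrictScalars ℝ) (fun z hz =>
    (((h.holo z hz).differentiableAt (by simp)).hasFDerivAt.restrictScalars ℝ).hasFDerivWithinAt)
    hinj]
  refine setIntegral_congr_fun h.isOpen.measurableSet fun z hz => ?_
  simp only
  rw [det_fderiv_eq, abs_of_nonneg (Complex.normSq_nonneg _), h.pullback z hz, det_sesqPullback,
    hf z hz, Complex.real_smul]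
  ring

/-- The squared norm `|η|² = g^{i j̄} ηᵢ conj ηⱼ`; real and nonnegative where `G` is positive
definite. -/
noncomputable def torsionNormSq (G : CSpace n → Matrix (Fin n) (Fin n) ℂ) (z : CSpace n) : ℂ :=
  traceH (metricInv G z) (Matrix.of fun i j => torsionTrace G i z * conj (torsionTrace G j z))

/-- The derivative `g^{i j̄} ηᵢ ∂_{j̄} f` of `f` along the vector field dual to `η`. -/
noncomputable def torsionDeriv (G : CSpace n → Matrix (Fin n) (Fin n) ℂ) (f : CSpace n → ℂ)
    (z : CSpace n) : ℂ :=
  traceH (metricInv G z) (Matrix.of fun i j => torsionTrace G i z * dZbar j f z)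

variable {G : CSpace n → Matrix (Fin n) (Fin n) ℂ} {z : CSpace n}

lemma torsionNormSq_nonneg (hG : (G z).PosDef) : 0 ≤ torsionNormSq G z := by
  have h := hG.transpose.inv.posSemidef.dotProduct_mulVec_nonneg
    (fun j => conj (torsionTrace G j z))
  convert h using 1
  simp only [torsionNormSq, traceH, dotProduct, Matrix.mulVec, Finset.mul_sum, Matrix.of_apply,
    metricInv]
  refine Finset.sum_congr rfl fun i _ => Finset.sum_congr rfl fun j _ => ?_
  simp; ring

lemma torsionTrace_eq_zero_of_normSq (hG : (G z).PosDef) (h : torsionNormSq G z = 0) (i : Fin n) :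
    torsionTrace G i z = 0 := by
  by_contra hi
  have hne : (fun j => conj (torsionTrace G j z)) ≠ 0 := fun h0 =>
    hi (by simpa using congrFun h0 i)
  have h1 := hG.transpose.inv.dotProduct_mulVec_pos hne
  refine h1.ne ?_
  rw [← h]
  simp only [torsionNormSq, traceH, dotProduct, Matrix.mulVec, Finset.mul_sum, Matrix.of_apply,
    metricInv]
  refine Finset.sum_congr rfl fun i _ => Finset.sum_congr rfl fun j _ => ?_
  simp; ring

lemma contDiffAt_torsionNormSq (hG : ∀ a b, ContDiffAt ℝ ∞ (fun w => G w a b) z)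
    (hdet : (G z).det ≠ 0) : ContDiffAt ℝ ∞ (torsionNormSq G) z := by
  unfold torsionNormSq traceH
  refine ContDiffAt.sum fun i _ => ContDiffAt.sum fun j _ =>
    (contDiffAt_metricInv hG hdet i j).mul ((contDiffAt_torsionTrace hG hdet i).mul ?_)
  exact Complex.conjCLE.contDiff.contDiffAt.comp z (contDiffAt_torsionTrace hG hdet j)

lemma contDiffAt_torsionDeriv (hG : ∀ a b, ContDiffAt ℝ ∞ (fun w => G w a b) z)
    (hdet : (G z).det ≠ 0) {f : CSpace n → ℂ} (hf : ContDiffAt ℝ ∞ f z) :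
    ContDiffAt ℝ ∞ (torsionDeriv G f) z := by
  unfold torsionDeriv traceH
  rw [dZbar_eq_wirt]
  exact ContDiffAt.sum fun i _ => ContDiffAt.sum fun j _ =>
    (contDiffAt_metricInv hG hdet i j).mul
      ((contDiffAt_torsionTrace hG hdet i).mul (contDiffAt_wirt hf))

lemma torsionDeriv_congr {f f' : CSpace n → ℂ} (h : f =ᶠ[nhds z] f') :
    torsionDeriv G f z = torsionDeriv G f' z := by
  simp only [torsionDeriv, dZbar_eq_wirt, wirt_congr h]

lemma torsionDeriv_const (a : ℂ) : torsionDeriv G (fun _ => a) z = 0 := by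
  simp [torsionDeriv, dZbar_eq_wirt, wirt_const, traceH]

lemma torsionDeriv_sum {ι : Type*} (s : Finset ι) {f : ι → CSpace n → ℂ}
    (hf : ∀ a ∈ s, DifferentiableAt ℝ (f a) z) :
    torsionDeriv G (fun w => ∑ a ∈ s, f a w) z = ∑ a ∈ s, torsionDeriv G (f a) z := by
  simp only [torsionDeriv, dZbar_eq_wirt, wirt_sum s hf, traceH, Matrix.of_apply, Finset.mul_sum]
  rw [Finset.sum_congr rfl fun i _ => Finset.sum_comm, Finset.sum_comm]

/-- Integration by parts against `η`, in one chart. -/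
lemma setIntegral_torsion_eq_zero (μ : Measure (CSpace n)) [μ.IsAddHaarMeasure]
    {U K : Set (CSpace n)} (hU : IsOpen U) (hK : IsCompact K) (hKU : K ⊆ U)
    (hG : ∀ z ∈ U, ∀ a b, ContDiffAt ℝ ∞ (fun w => G w a b) z) (hpos : ∀ z ∈ U, (G z).PosDef)
    (htr : ∀ z ∈ U, traceH (metricInv G z)
      (Matrix.of fun i j => dZbar j (torsionTrace G i) z) = 0)
    {f : CSpace n → ℂ} (hf : ∀ z ∈ U, ContDiffAt ℝ ∞ f z) (hf0 : ∀ z ∈ U, z ∉ K → f z = 0) :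
    ∫ z in U, (G z).det * (f z * torsionNormSq G z) ∂μ
      = -∫ z in U, (G z).det * torsionDeriv G f z ∂μ := by
  have hdet : ∀ z ∈ U, (G z).det ≠ 0 := fun z hz => (hpos z hz).det_pos.ne'
  have h1 := setIntegral_divergence_eq_zero μ hU hK hKU
    (F := fun s w => f w * ∑ k, (G w).adjugate s k * torsionTrace G k w)
    (fun s z hz => (hf z hz).mul (ContDiffAt.sum fun k _ =>
      (contDiffAt_adjugate (hG z hz) s k).mul (contDiffAt_torsionTrace (hG z hz) (hdet z hz) k)))
    (fun s z hz hzK => by rw [hf0 z hz hzK, zero_mul])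
  have hD : ContinuousOn (fun z => (G z).det) U := fun z hz =>
    (contDiffAt_det (hG z hz)).continuousAt.continuousWithinAt
  have hfz : ∀ z ∈ U, z ∉ K → torsionDeriv G f z = 0 := by
    intro z hz hzK
    have : f =ᶠ[nhds z] fun _ => 0 := by
      filter_upwards [(hU.sdiff hK.isClosed).mem_nhds ⟨hz, hzK⟩] with w hw using hf0 w hw.1 hw.2
    rw [torsionDeriv_congr this, torsionDeriv_const]
  have i1 : IntegrableOn (fun z => (G z).det * (f z * torsionNormSq G z)) U μ :=
    integrableOn_of_compact μ hU hK hKU (hD.mul fun z hz => ((hf z hz).mul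
      (contDiffAt_torsionNormSq (hG z hz) (hdet z hz))).continuousAt.continuousWithinAt)
      fun z hz hzK => by rw [hf0 z hz hzK]; simp
  have i2 : IntegrableOn (fun z => (G z).det * torsionDeriv G f z) U μ :=
    integrableOn_of_compact μ hU hK hKU (hD.mul fun z hz =>
      (contDiffAt_torsionDeriv (hG z hz) (hdet z hz) (hf z hz)).continuousAt.continuousWithinAt)
      fun z hz hzK => by rw [hfz z hz hzK]; simp
  rw [eq_neg_iff_add_eq_zero, ← integral_add i1 i2, ← h1]
  refine setIntegral_congr_fun hU.measurableSet fun z hz => ?_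
  rw [divergence_torsionTrace (hG z hz) (hdet z hz)
    (Filter.mem_of_superset (hU.mem_nhds hz) fun w hw => (hpos w hw).isHermitian) (htr z hz)
    (hf z hz).differentiableAt_infty, ← mul_add]
  rfl

end Integration

/-! ### Integration over the manifold -/

section PartitionOfUnity

variable {n : ℕ} {M : Type*} [TopologicalSpace M] [ChartedSpace (CSpace n) M]

/-- A complex manifold is a smooth real manifold. -/
lemma isManifold_real [IsManifold 𝓘(ℂ, CSpace n) ω M] : IsManifold 𝓘(ℝ, CSpace n) ∞ M := by
  refine isManifold_of_contDiffOn _ _ _ fun e e' he he' => ?_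
  have h := (contDiffGroupoid ω 𝓘(ℂ, CSpace n)).compatible he he'
  rw [contDiffGroupoid, mem_groupoid_of_pregroupoid] at h
  have h1 : ContDiffOn ℂ ω (e' ∘ e.symm) (e.symm.trans e').source := by
    simpa [contDiffPregroupoid] using h.1
  have h2 : ContDiffOn ℝ ∞ (e' ∘ e.symm) (e.symm.trans e').source :=
    (h1.restrict_scalars ℝ).of_le le_top
  simpa using h2

/-- A finite smooth partition of unity subordinate to holomorphic charts. -/
lemma exists_finite_partition [T2Space M] [CompactSpace M] [IsManifold 𝓘(ℂ, CSpace n) ω M] :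
    ∃ (t : Finset M) (ρ : t → M → ℝ), (∀ a x, 0 ≤ ρ a x) ∧ (∀ x, ∑ a, ρ a x = 1) ∧
      (∀ a, tsupport (ρ a) ⊆ (chartAt (CSpace n) (a : M)).source) ∧
      ∀ a (x : M), ContDiffOn ℝ ∞ (ρ a ∘ (chartAt (CSpace n) x).symm)
        (chartAt (CSpace n) x).target := by
  have : IsManifold 𝓘(ℝ, CSpace n) ∞ M := isManifold_real
  obtain ⟨t, ht⟩ := isCompact_univ.elim_finite_subcover
    (fun x : M => (chartAt (CSpace n) x).source) (fun x => (chartAt (CSpace n) x).open_source)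
    (fun x _ => Set.mem_iUnion.2 ⟨x, mem_chart_source _ x⟩)
  obtain ⟨ρ, hρ⟩ := SmoothPartitionOfUnity.exists_isSubordinate 𝓘(ℝ, CSpace n)
    (isClosed_univ (X := M)) (fun a : t => (chartAt (CSpace n) (a : M)).source)
    (fun a => (chartAt (CSpace n) (a : M)).open_source)
    (fun x hx => by simpa using ht hx)
  refine ⟨t, fun a => ρ a, fun a x => ρ.nonneg a x, fun x => ?_, hρ, fun a x => ?_⟩
  · rw [← finsum_eq_sum_of_fintype]
    exact ρ.sum_eq_one (Set.mem_univ x)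
  · have h1 : ContMDiff 𝓘(ℝ, CSpace n) 𝓘(ℝ, ℝ) ∞ (ρ a) := (ρ a).contMDiff
    exact (h1.comp_contMDiffOn (contMDiffOn_chart_symm (x := x))).contDiffOn

end PartitionOfUnity

namespace HermitianMetric

open MeasureTheory Set

variable {n : ℕ} {M : Type*} [TopologicalSpace M] [ChartedSpace (CSpace n) M]
  (g : HermitianMetric n M)

/-- The derivative of a function on `M` along the vector field dual to `η`, computed in two
charts, has the same integral. -/
lemma setIntegral_torsionDeriv_change [IsManifold 𝓘(ℂ, CSpace n) ω M]
    (μ : Measure (CSpace n)) [μ.IsAddHaarMeasure]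
    {e e' : OpenPartialHomeomorph M (CSpace n)}
    (he : e ∈ IsManifold.maximalAtlas 𝓘(ℂ, CSpace n) ω M)
    (he' : e' ∈ IsManifold.maximalAtlas 𝓘(ℂ, CSpace n) ω M) {σ τ : M → ℝ}
    (hσ : tsupport σ ⊆ e.source) (hτ : tsupport τ ⊆ e'.source)
    (hσ' : ContDiffOn ℝ ∞ (σ ∘ e'.symm) e'.target) :
    ∫ z in e.target, (g.coeffMatrix e z).det * (τ (e.symm z) *
        torsionDeriv (g.coeffMatrix e) (fun w => (σ (e.symm w) : ℂ)) z) ∂μ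
      = ∫ z in e'.target, (g.coeffMatrix e' z).det * (τ (e'.symm z) *
        torsionDeriv (g.coeffMatrix e') (fun w => (σ (e'.symm w) : ℂ)) z) ∂μ := by
  have hch := g.isMetricChange he he'
  have hsrc : ∀ w, w ∈ (e.symm.trans e').source ↔ w ∈ e.target ∧ e.symm w ∈ e'.source := by
    intro w; simp
  have hinj : InjOn (e' ∘ e.symm) (e.symm.trans e').source := (e.symm.trans e').injOn
  have himg : (e' ∘ e.symm) '' (e.symm.trans e').source = (e'.symm.trans e).source := by
    have h1 := (e.symm.trans e').image_source_eq_target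
    rw [show (e.symm.trans e').target = (e'.symm.trans e).source from by
      ext w; simp] at h1
    exact h1
  have hsrc' : ∀ w, w ∈ (e'.symm.trans e).source ↔ w ∈ e'.target ∧ e'.symm w ∈ e.source := by
    intro w; simp
  -- restrict both integrals to the overlap of the two charts
  have h1 : ∫ z in e.target, (g.coeffMatrix e z).det * (τ (e.symm z) *
        torsionDeriv (g.coeffMatrix e) (fun w => (σ (e.symm w) : ℂ)) z) ∂μ
      = ∫ z in (e.symm.trans e').source, (g.coeffMatrix e z).det * (τ (e.symm z) *
        torsionDeriv (g.coeffMatrix e) (fun w => (σ (e.symm w) : ℂ)) z) ∂μ := by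
    refine setIntegral_eq_of_subset_of_forall_sdiff_eq_zero e.open_target.measurableSet
      (fun w hw => ((hsrc w).1 hw).1) fun w hw => ?_
    have : τ (e.symm w) = 0 := image_eq_zero_of_notMem_tsupport fun h =>
      hw.2 ((hsrc w).2 ⟨hw.1, hτ h⟩)
    rw [this]; simp
  have h2 : ∫ z in e'.target, (g.coeffMatrix e' z).det * (τ (e'.symm z) *
        torsionDeriv (g.coeffMatrix e') (fun w => (σ (e'.symm w) : ℂ)) z) ∂μ
      = ∫ z in (e'.symm.trans e).source, (g.coeffMatrix e' z).det * (τ (e'.symm z) *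
        torsionDeriv (g.coeffMatrix e') (fun w => (σ (e'.symm w) : ℂ)) z) ∂μ := by
    refine setIntegral_eq_of_subset_of_forall_sdiff_eq_zero e'.open_target.measurableSet
      (fun w hw => ((hsrc' w).1 hw).1) fun w hw => ?_
    have hw2 : e'.symm w ∉ tsupport σ := fun h => hw.2 ((hsrc' w).2 ⟨hw.1, hσ h⟩)
    have hev : (fun w => (σ (e'.symm w) : ℂ)) =ᶠ[nhds w] fun _ => 0 := by
      have hc := (e'.continuousAt_symm hw.1).eventually
        ((isClosed_tsupport σ).isOpen_compl.mem_nhds hw2)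
      filter_upwards [hc] with x hx
      rw [image_eq_zero_of_notMem_tsupport hx]; simp
    rw [torsionDeriv_congr hev, torsionDeriv_const]; simp
  rw [h1, h2, ← himg]
  refine hch.setIntegral_eq μ hinj fun z hz => ?_
  obtain ⟨hz1, hz2⟩ := (hsrc z).1 hz
  have hleft : ∀ w ∈ (e.symm.trans e').source, e'.symm ((e' ∘ e.symm) w) = e.symm w := fun w hw =>
    e'.left_inv ((hsrc w).1 hw).2
  rw [hleft z hz]
  congr 1
  have hd : DifferentiableAt ℝ (fun w => (σ (e'.symm w) : ℂ)) ((e' ∘ e.symm) z) := by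
    have h3 : ContDiffAt ℝ ∞ (σ ∘ e'.symm) ((e' ∘ e.symm) z) :=
      hσ'.contDiffAt (e'.open_target.mem_nhds (e'.map_source hz2))
    exact Complex.ofRealCLM.differentiableAt.comp _ (h3.differentiableAt (by simp))
  exact hch.traceH_torsionTrace_dZbar hz hd fun w hw => by rw [hleft w hw]

/-- If the trace of `∂̄η` vanishes, then so does `η`: the integral of `|η|²` over `M` is that of a
divergence. -/
lemma torsionTrace_eq_zero [T2Space M] [CompactSpace M] [IsManifold 𝓘(ℂ, CSpace n) ω M]
    (htr : ∀ e ∈ IsManifold.maximalAtlas 𝓘(ℂ, CSpace n) ω M, ∀ z ∈ e.target,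
      traceH (metricInv (g.coeffMatrix e) z)
        (Matrix.of fun i j => dZbar j (torsionTrace (g.coeffMatrix e) i) z) = 0)
    {e : OpenPartialHomeomorph M (CSpace n)}
    (he : e ∈ IsManifold.maximalAtlas 𝓘(ℂ, CSpace n) ω M) {z : CSpace n} (hz : z ∈ e.target)
    (i : Fin n) : torsionTrace (g.coeffMatrix e) i z = 0 := by
  obtain ⟨t, ρ, hρ0, hρ1, hsub, hsm⟩ := exists_finite_partition (n := n) (M := M)
  let μ : Measure (CSpace n) := Measure.addHaar
  let E : t → OpenPartialHomeomorph M (CSpace n) := fun a => chartAt (CSpace n) (a : M)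
  have hE : ∀ a, E a ∈ IsManifold.maximalAtlas 𝓘(ℂ, CSpace n) ω M := fun a =>
    IsManifold.chart_mem_maximalAtlas _
  -- the compact support of `ρ a` in the chart `E a`
  let K : t → Set (CSpace n) := fun a => E a '' tsupport (ρ a)
  have hK : ∀ a, IsCompact (K a) := fun a =>
    (isClosed_tsupport (ρ a)).isCompact.image_of_continuousOn ((E a).continuousOn.mono (hsub a))
  have hKU : ∀ a, K a ⊆ (E a).target := by
    rintro a _ ⟨x, hx, rfl⟩; exact (E a).map_source (hsub a hx)
  have hK0 : ∀ a, ∀ w ∈ (E a).target, w ∉ K a → ρ a ((E a).symm w) = 0 := fun a w hw hwK =>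
    image_eq_zero_of_notMem_tsupport fun h => hwK ⟨_, h, (E a).right_inv hw⟩
  have hsmooth : ∀ a b, ∀ w ∈ (E b).target,
      ContDiffAt ℝ ∞ (fun w => (ρ a ((E b).symm w) : ℂ)) w := fun a b w hw =>
    Complex.ofRealCLM.contDiff.contDiffAt.comp w
      ((hsm a b).contDiffAt ((E b).open_target.mem_nhds hw))
  have hG := fun a w (hw : w ∈ (E a).target) => g.contDiffAt_coeffMatrix (hE a) hw
  have hpos := fun a w (hw : w ∈ (E a).target) => g.posDef_coeffMatrix (hE a) hw
  have hD : ∀ a, ContinuousOn (fun w => (g.coeffMatrix (E a) w).det) (E a).target :=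
    fun a w hw => (contDiffAt_det (hG a w hw)).continuousAt.continuousWithinAt
  -- `Φ c b a` is `ρ b` times the derivative of `ρ a` along the dual of `η`, in the chart `E c`
  let Φ : t → t → t → CSpace n → ℂ := fun c b a w => (g.coeffMatrix (E c) w).det *
    (ρ b ((E c).symm w) * torsionDeriv (g.coeffMatrix (E c)) (fun w => (ρ a ((E c).symm w) : ℂ)) w)
  have hΦc : ∀ c b a, ContinuousOn (Φ c b a) (E c).target := fun c b a =>
    (hD c).mul fun w hw => ((hsmooth b c w hw).mul (contDiffAt_torsionDeriv (hG c w hw)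
      (hpos c w hw).det_pos.ne' (hsmooth a c w hw))).continuousAt.continuousWithinAt
  have hW0 : ∀ a, ∀ w ∈ (E a).target, w ∉ K a →
      torsionDeriv (g.coeffMatrix (E a)) (fun w => (ρ a ((E a).symm w) : ℂ)) w = 0 := by
    intro a w hw hwK
    have : (fun w => (ρ a ((E a).symm w) : ℂ)) =ᶠ[nhds w] fun _ => 0 := by
      filter_upwards [((E a).open_target.sdiff (hK a).isClosed).mem_nhds ⟨hw, hwK⟩] with x hx
      rw [hK0 a x hx.1 hx.2]; simp
    rw [torsionDeriv_congr this, torsionDeriv_const]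
  have hΦ1 : ∀ b a, IntegrableOn (Φ b b a) (E b).target μ := fun b a =>
    integrableOn_of_compact μ (E b).open_target (hK b) (hKU b) (hΦc b b a) fun w hw hwK => by
      simp only [Φ]; rw [hK0 b w hw hwK]; simp
  have hΦ2 : ∀ b a, IntegrableOn (Φ a b a) (E a).target μ := fun b a =>
    integrableOn_of_compact μ (E a).open_target (hK a) (hKU a) (hΦc a b a) fun w hw hwK => by
      simp only [Φ]; rw [hW0 a w hw hwK]; simp
  let N : t → CSpace n → ℂ := fun a w => (g.coeffMatrix (E a) w).det *
    (ρ a ((E a).symm w) * torsionNormSq (g.coeffMatrix (E a)) w)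
  have hNc : ∀ a, ContinuousOn (N a) (E a).target := fun a =>
    (hD a).mul fun w hw => ((hsmooth a a w hw).mul (contDiffAt_torsionNormSq (hG a w hw)
      (hpos a w hw).det_pos.ne')).continuousAt.continuousWithinAt
  have hNi : ∀ a, IntegrableOn (N a) (E a).target μ := fun a =>
    integrableOn_of_compact μ (E a).open_target (hK a) (hKU a) (hNc a) fun w hw hwK => by
      simp only [N]; rw [hK0 a w hw hwK]; simp
  have hN0 : ∀ a, ∀ w ∈ (E a).target, 0 ≤ N a w := fun a w hw =>
    mul_nonneg (hpos a w hw).det_pos.le (mul_nonneg (by exact_mod_cast hρ0 a _)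
      (torsionNormSq_nonneg (hpos a w hw)))
  -- integrate by parts in each chart
  have h1 : ∀ a, ∫ w in (E a).target, N a w ∂μ
      = -∫ w in (E a).target, ∑ b, Φ a b a w ∂μ := by
    intro a
    have := setIntegral_torsion_eq_zero μ (E a).open_target (hK a) (hKU a) (hG a) (hpos a)
      (htr (E a) (hE a)) (hsmooth a a) fun w hw hwK => by rw [hK0 a w hw hwK]; simp
    rw [this]
    congr 1
    refine setIntegral_congr_fun (E a).open_target.measurableSet fun w hw => ?_
    have hone : ∑ b, (ρ b ((E a).symm w) : ℂ) = 1 := by exact_mod_cast hρ1 _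
    simp only [Φ]
    rw [← Finset.mul_sum, ← Finset.sum_mul, hone, one_mul]
  -- move the terms to the charts of the inserted factors `ρ b` and sum over `a`
  have h2 : ∑ a, ∫ w in (E a).target, N a w ∂μ = 0 := by
    have h3 : ∀ b, ∑ a, ∫ w in (E b).target, Φ b b a w ∂μ = 0 := by
      intro b
      rw [← integral_finsetSum _ fun a _ => hΦ1 b a]
      refine setIntegral_eq_zero_of_forall_eq_zero fun w hw => ?_
      simp only [Φ]
      rw [← Finset.mul_sum, ← Finset.mul_sum, ← torsionDeriv_sum _ fun a _ =>
        (hsmooth a b w hw).differentiableAt_infty]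
      have hone : (fun w => ∑ a, (ρ a ((E b).symm w) : ℂ)) = fun _ => 1 := by
        funext x; exact_mod_cast hρ1 _
      rw [hone, torsionDeriv_const, mul_zero, mul_zero]
    have h4 : ∀ a b, ∫ w in (E a).target, Φ a b a w ∂μ = ∫ w in (E b).target, Φ b b a w ∂μ :=
      fun a b => g.setIntegral_torsionDeriv_change μ (hE a) (hE b) (hsub a) (hsub b) (hsm a b)
    calc ∑ a, ∫ w in (E a).target, N a w ∂μ
        = -∑ a, ∑ b, ∫ w in (E a).target, Φ a b a w ∂μ := by
          rw [← Finset.sum_neg_distrib]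
          refine Finset.sum_congr rfl fun a _ => ?_
          rw [h1, integral_finsetSum _ fun b _ => hΦ2 b a]
      _ = -∑ b, ∑ a, ∫ w in (E b).target, Φ b b a w ∂μ := by
          rw [Finset.sum_congr rfl fun a _ => Finset.sum_congr rfl fun b _ => h4 a b,
            Finset.sum_comm]
      _ = 0 := by simp only [h3, Finset.sum_const_zero, neg_zero]
  -- each of the integrals is nonnegative, hence zero
  have h5 : ∀ a, ∫ w in (E a).target, (N a w).re ∂μ = 0 := by
    have h6 : ∑ a, ∫ w in (E a).target, (N a w).re ∂μ = 0 := by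
      have := congrArg Complex.re h2
      rw [Complex.re_sum] at this
      rw [← Complex.zero_re, ← this]
      exact Finset.sum_congr rfl fun a _ => integral_re (hNi a)
    have h7 : ∀ a ∈ Finset.univ, 0 ≤ ∫ w in (E a).target, (N a w).re ∂μ := fun a _ =>
      setIntegral_nonneg (E a).open_target.measurableSet fun w hw =>
        (Complex.nonneg_iff.1 (hN0 a w hw)).1
    exact fun a => (Finset.sum_eq_zero_iff_of_nonneg h7).1 h6 a (Finset.mem_univ a)
  have h8 : ∀ a, ∀ w ∈ (E a).target, N a w = 0 := by
    intro a
    have h9 := (setIntegral_eq_zero_iff_of_nonneg_ae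
      ((ae_restrict_iff' (E a).open_target.measurableSet).2 (Filter.Eventually.of_forall
        fun w hw => (Complex.nonneg_iff.1 (hN0 a w hw)).1)) (hNi a).re).1 (h5 a)
    have h10 := Measure.eqOn_open_of_ae_eq h9 (E a).open_target
      (Complex.continuous_re.comp_continuousOn (hNc a)) continuousOn_const
    exact fun w hw => Complex.ext (h10 hw) (Complex.nonneg_iff.1 (hN0 a w hw)).2.symm
  -- choose a chart with `ρ a ≠ 0` at the given point
  obtain ⟨a, ha⟩ : ∃ a, ρ a (e.symm z) ≠ 0 := by
    by_contra! h
    have := hρ1 (e.symm z)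
    simp [h] at this
  have hmem : e.symm z ∈ (E a).source := hsub a (subset_tsupport _ ha)
  have hzU : z ∈ (e.symm.trans (E a)).source := by
    simp only [OpenPartialHomeomorph.trans_source, OpenPartialHomeomorph.symm_source]
    exact ⟨hz, hmem⟩
  have hw : E a (e.symm z) ∈ (E a).target := (E a).map_source hmem
  have h11 : torsionNormSq (g.coeffMatrix (E a)) (E a (e.symm z)) = 0 := by
    have h12 := h8 a _ hw
    simp only [N] at h12
    rw [(E a).left_inv hmem] at h12
    exact (mul_eq_zero.1 ((mul_eq_zero.1 h12).resolve_left (hpos a _ hw).det_pos.ne')).resolve_left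
      (by exact_mod_cast ha)
  rw [(g.isMetricChange he (hE a)).torsionTrace_eq hzU]
  exact Finset.sum_eq_zero fun m _ => by
    rw [show (E a ∘ e.symm) z = E a (e.symm z) from rfl,
      torsionTrace_eq_zero_of_normSq (hpos a _ hw) h11, mul_zero]

end HermitianMetric

/-! ### The cofactor matrix and forms of bidegree `(n, n - 1)` -/

section Cofactor

variable {m : ℕ} {W : Type*} [AddCommGroup W] [Module ℂ W]

/-- The value of `dz^k ∧ ω^m`, up to sign, for `ω = ∑ A_{ij} dzⁱ ∧ dz̄ʲ` and `n = m + 1`. The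
covectors `dzⁱ`, `dz̄ʲ` are the abstract vectors `x i`, `y j`, and the wedge product is an alternating
form `D` in which the `n` factors of type `(1,0)` come before the `n - 1` of type `(0,1)`. -/
noncomputable def wedgeSum (D : W [⋀^Fin (m + 1) ⊕ Fin m]→ₗ[ℂ] ℂ) (x y : Fin (m + 1) → W)
    (A : Matrix (Fin (m + 1)) (Fin (m + 1)) ℂ) (k : Fin (m + 1)) : ℂ :=
  ∑ I : Fin m → Fin (m + 1),
    D (Sum.elim (x ∘ Fin.cons k I) fun a => Fintype.linearCombination ℂ y (A (I a)))

lemma AlternatingMap.map_sumElim_comp_perm (D : W [⋀^Fin (m + 1) ⊕ Fin m]→ₗ[ℂ] ℂ)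
    (x : Fin (m + 1) → W) (σ : Equiv.Perm (Fin (m + 1))) (ζ : Fin m → W) :
    D (Sum.elim (x ∘ σ) ζ) = Equiv.Perm.sign σ • D (Sum.elim x ζ) := by
  have h := D.map_perm (Sum.elim x ζ) (Equiv.Perm.sumCongr σ 1)
  rw [Equiv.Perm.sign_sumCongr, Equiv.Perm.sign_one, mul_one] at h
  rw [← h]
  congr 1
  ext i
  rcases i with i | i <;> simp

lemma sum_function_eq_sum_perm {ι R : Type*} [Fintype ι] [DecidableEq ι] [AddCommMonoid R]
    {f : (ι → ι) → R} (hf : ∀ K, ¬ Function.Injective K → f K = 0) :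
    ∑ K, f K = ∑ σ : Equiv.Perm ι, f σ := by
  symm
  refine Finset.sum_of_injOn (fun σ : Equiv.Perm ι => (σ : ι → ι))
    Equiv.coe_fn_injective.injOn (by simp) ?_ (fun _ _ => rfl)
  intro K _ hK
  refine hf K fun h => hK ?_
  exact ⟨Equiv.ofBijective K (Finite.injective_iff_bijective.1 h), by simp, rfl⟩

/-- Weighted by a linear form of the rows, the sums `wedgeSum D x y A k` add up to an alternating
function of the rows of `A`, which is a multiple of the determinant. -/
lemma sum_mul_wedgeSum (D : W [⋀^Fin (m + 1) ⊕ Fin m]→ₗ[ℂ] ℂ) (x y : Fin (m + 1) → W)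
    (c : (Fin (m + 1) → ℂ) →ₗ[ℂ] ℂ) (A : Matrix (Fin (m + 1)) (Fin (m + 1)) ℂ) :
    ∑ k, c (A k) * wedgeSum D x y A k
      = A.det * ∑ k, c (Pi.single k 1) * wedgeSum D x y 1 k := by
  let B : MultilinearMap ℂ (fun _ : Fin m => Fin (m + 1) → ℂ) ℂ :=
    (D.toMultilinearMap.currySum x).compLinearMap fun _ => Fintype.linearCombination ℂ y
  let Mu : MultilinearMap ℂ (fun _ : Fin (m + 1) => Fin (m + 1) → ℂ) ℂ :=
    LinearMap.uncurryLeft (c.smulRight B)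
  let T := MultilinearMap.alternatization Mu
  have hT : ∀ A : Matrix (Fin (m + 1)) (Fin (m + 1)) ℂ,
      T A = ∑ k, c (A k) * wedgeSum D x y A k := by
    intro A
    have h1 : ∑ k, c (A k) * wedgeSum D x y A k = ∑ K : Fin (m + 1) → Fin (m + 1), c (A (K 0))
        * D (Sum.elim (x ∘ K) fun a => Fintype.linearCombination ℂ y (A (K a.succ))) := by
      simp only [wedgeSum, Finset.mul_sum]
      rw [← Fintype.sum_prod_type']
      exact Fintype.sum_equiv (Fin.consEquiv fun _ => Fin (m + 1)) _ _ fun p => rfl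
    rw [h1]
    refine (MultilinearMap.alternatization_apply Mu A).trans ?_
    rw [sum_function_eq_sum_perm]
    · refine Finset.sum_congr rfl fun σ _ => ?_
      rw [D.map_sumElim_comp_perm, mul_smul_comm]
      rfl
    · intro K hK
      rw [D.map_eq_zero_of_not_injective, mul_zero]
      exact fun h => hK fun a b hab => Sum.inl_injective (h (by simp [hab]))
  have h2 : T A = T (Pi.basisFun ℂ (Fin (m + 1))) * A.det := by
    conv_lhs => rw [T.eq_smul_basis_det (Pi.basisFun ℂ (Fin (m + 1)))]
    rw [Pi.basisFun_det]
    rfl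
  have h3 : T (Pi.basisFun ℂ (Fin (m + 1)))
      = ∑ k, c (Pi.single k 1) * wedgeSum D x y 1 k := by
    have h4 : (⇑(Pi.basisFun ℂ (Fin (m + 1))) : Fin (m + 1) → Fin (m + 1) → ℂ)
        = (1 : Matrix (Fin (m + 1)) (Fin (m + 1)) ℂ) := by
      ext i j
      simp [Matrix.one_apply, Pi.single_apply, eq_comm]
    have h5 : ∀ k, (1 : Matrix (Fin (m + 1)) (Fin (m + 1)) ℂ) k = Pi.single k 1 := by
      intro k; ext j; simp [Matrix.one_apply, Pi.single_apply, eq_comm]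
    rw [h4, hT]
    simp only [h5]
  rw [← hT, h2, h3, mul_comm]

/-- `dz^k ∧ ω^m` depends on `ω` only through the cofactors of its coefficients. This is the case of
`sum_mul_wedgeSum` for a linear form that takes the values `A l ↦ det A · δ_{lk}` on the rows. -/
lemma wedgeSum_eq_sum_adjugate (D : W [⋀^Fin (m + 1) ⊕ Fin m]→ₗ[ℂ] ℂ) (x y : Fin (m + 1) → W)
    {A : Matrix (Fin (m + 1)) (Fin (m + 1)) ℂ} (hA : A.det ≠ 0) (k : Fin (m + 1)) :
    wedgeSum D x y A k = ∑ s, A.adjugate s k * wedgeSum D x y 1 s := by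
  let c : (Fin (m + 1) → ℂ) →ₗ[ℂ] ℂ :=
    Fintype.linearCombination ℂ (fun j => A.adjugate j k)
  have hc : ∀ r, c r = ∑ j, r j * A.adjugate j k := fun r => by
    simp [c, Fintype.linearCombination_apply]
  have h := sum_mul_wedgeSum D x y c A
  have h1 : ∀ l, c (A l) = if l = k then A.det else 0 := by
    intro l
    have := congrFun (congrFun A.mul_adjugate l) k
    rw [Matrix.mul_apply] at this
    rw [hc, this]
    simp [Matrix.one_apply]
  have h2 : ∀ s, c (Pi.single s 1) = A.adjugate s k := by
    intro s; rw [hc]; simp [Pi.single_apply]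
  simp only [h1, h2, ite_mul, zero_mul, Finset.sum_ite_eq', Finset.mem_univ, if_true] at h
  exact mul_left_cancel₀ hA h

/-- The expansion of `dz^k ∧ ω^m` into monomials in the coefficients of `ω`. -/
lemma sum_prod_mul_eq_wedgeSum (D : W [⋀^Fin (m + 1) ⊕ Fin m]→ₗ[ℂ] ℂ) (x y : Fin (m + 1) → W)
    (A : Matrix (Fin (m + 1)) (Fin (m + 1)) ℂ) (k : Fin (m + 1)) :
    ∑ P : Fin m → Fin (m + 1) × Fin (m + 1), (∏ a, A (P a).1 (P a).2)
      * D (Sum.elim (x ∘ Fin.cons k fun a => (P a).1) fun a => y (P a).2)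
      = wedgeSum D x y A k := by
  rw [← Fintype.sum_equiv (Equiv.arrowProdEquivProdArrow (Fin m) (fun _ => Fin (m + 1))
    (fun _ => Fin (m + 1))).symm (fun p => (∏ a, A (p.1 a) (p.2 a))
      * D (Sum.elim (x ∘ Fin.cons k p.1) (y ∘ p.2))) _ fun p => rfl, Fintype.sum_prod_type]
  refine Finset.sum_congr rfl fun I _ => ?_
  let B := D.toMultilinearMap.currySum (x ∘ Fin.cons k I)
  have h1 : D (Sum.elim (x ∘ Fin.cons k I) fun a => Fintype.linearCombination ℂ y (A (I a)))
      = B fun a => ∑ j, A (I a) j • y j := by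
    simp only [Fintype.linearCombination_apply]; rfl
  rw [h1, MultilinearMap.map_sum]
  refine Finset.sum_congr rfl fun J _ => ?_
  rw [MultilinearMap.map_smul_univ, smul_eq_mul]
  rfl

/-- If the divergence of the cofactor matrix of `G` vanishes, then so does the sum of the
coefficients of `∂(ω^m)`, for an `ω` with coefficients `G`. -/
lemma sum_wirt_prod_eq_zero (D : W [⋀^Fin (m + 1) ⊕ Fin m]→ₗ[ℂ] ℂ)
    (x y : Fin (m + 1) → W) {G : CSpace (m + 1) → Matrix (Fin (m + 1)) (Fin (m + 1)) ℂ}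
    {z : CSpace (m + 1)} (hG : ∀ a b, ContDiffAt ℝ ∞ (fun w => G w a b) z)
    (hdet : (G z).det ≠ 0) (c : ℂ)
    (hdiv : ∀ s, ∑ k, wirt c k (fun w => (G w).adjugate s k) z = 0) :
    ∑ k, ∑ P : Fin m → Fin (m + 1) × Fin (m + 1),
      wirt c k (fun w => ∏ a, G w (P a).1 (P a).2) z
        * D (Sum.elim (x ∘ Fin.cons k fun a => (P a).1) fun a => y (P a).2) = 0 := by
  have hprod : ∀ P : Fin m → Fin (m + 1) × Fin (m + 1),
      DifferentiableAt ℝ (fun w => ∏ a, G w (P a).1 (P a).2) z := fun P =>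
    differentiableAt_finsetProd _ fun a _ => (hG _ _).differentiableAt_infty
  have hadj : ∀ s k, DifferentiableAt ℝ (fun w => (G w).adjugate s k) z := fun s k =>
    (contDiffAt_adjugate hG s k).differentiableAt_infty
  have key : ∀ k, ∑ P : Fin m → Fin (m + 1) × Fin (m + 1),
      wirt c k (fun w => ∏ a, G w (P a).1 (P a).2) z
        * D (Sum.elim (x ∘ Fin.cons k fun a => (P a).1) fun a => y (P a).2)
      = ∑ s, wirt c k (fun w => (G w).adjugate s k) z * wedgeSum D x y 1 s := by
    intro k
    have h1 : ∀ P : Fin m → Fin (m + 1) × Fin (m + 1), ∀ b : ℂ,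
        wirt c k (fun w => ∏ a, G w (P a).1 (P a).2) z * b
          = wirt c k (fun w => b * ∏ a, G w (P a).1 (P a).2) z := fun P b => by
      rw [wirt_const_mul b (hprod P), mul_comm]
    have h2 : ∀ s, ∀ b : ℂ, wirt c k (fun w => (G w).adjugate s k) z * b
        = wirt c k (fun w => b * (G w).adjugate s k) z := fun s b => by
      rw [wirt_const_mul b (hadj s k), mul_comm]
    simp only [h1, h2]
    rw [← wirt_sum _ fun P _ => (hprod P).const_mul _,
      ← wirt_sum _ fun s _ => (hadj s k).const_mul _]
    refine wirt_congr ?_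
    filter_upwards [eventually_det_ne_zero hG hdet] with w hw
    have h3 := wedgeSum_eq_sum_adjugate D x y hw k
    rw [← sum_prod_mul_eq_wedgeSum] at h3
    simpa only [mul_comm] using h3
  rw [Finset.sum_congr rfl fun k _ => key k, Finset.sum_comm]
  refine Finset.sum_eq_zero fun s _ => ?_
  rw [← Finset.sum_mul, hdiv, zero_mul]

end Cofactor

/-! ### The exterior derivative of `ω^m` -/

section KahlerPower

variable {n m : ℕ}

/-- The form `f₀ ∧ ⋯ ∧ f_{N-1}`, whose values are the determinants of `(f_r (u_s))`. -/
noncomputable def wedgeRows {N : ℕ} (f : Fin N → CSpace n →L[ℝ] ℂ) :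
    CSpace n [⋀^Fin N]→L[ℝ] ℂ :=
  ContinuousMultilinearMap.alternatization
    ((ContinuousMultilinearMap.mkPiAlgebra ℝ (Fin N) ℂ).compContinuousLinearMap f)

lemma wedgeRows_apply {N : ℕ} (f : Fin N → CSpace n →L[ℝ] ℂ) (u : Fin N → CSpace n) :
    wedgeRows f u = (Matrix.of fun r s => f r (u s)).det := by
  rw [wedgeRows, ContinuousMultilinearMap.alternatization_apply_apply, ← Matrix.det_transpose,
    Matrix.det_apply]
  rfl

/-- The sequence `a_{P₀}, b_{P₀}, a_{P₁}, b_{P₁}, …`. -/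
def interlace {S V : Type*} (a b : S → V) (P : Fin m → S) (r : Fin (m * 2)) : V :=
  if (finProdFinEquiv.symm r).2 = 0 then a (P (finProdFinEquiv.symm r).1)
  else b (P (finProdFinEquiv.symm r).1)

/-- `(∑ₚ cₚ aₚ ∧ bₚ)^m = ∑_P (∏ᵢ c_{Pᵢ}) a_{P₀} ∧ b_{P₀} ∧ a_{P₁} ∧ b_{P₁} ∧ ⋯`. -/
lemma formPow_sum_wedgeOne {S : Type*} [Fintype S] [DecidableEq S] (c : S → ℂ)
    (a b : S → CSpace n →L[ℝ] ℂ) (m : ℕ) :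
    formPow (∑ p, c p • wedgeOne (a p) (b p)) m
      = ∑ P : Fin m → S, (∏ i, c (P i)) • wedgeRows (interlace a b P) := by
  set θ := ∑ p, c p • wedgeOne (a p) (b p) with hθdef
  ext u
  have hθ : ∀ w : Fin 2 → CSpace n, θ w = ∑ p, ∑ π : Equiv.Perm (Fin 2),
      c p * (Equiv.Perm.sign π • ∏ t, (if t = 0 then a p else b p) (w (π t))) := by
    intro w
    simp only [hθdef, wedgeOne, ContinuousAlternatingMap.sum_apply,
      ContinuousAlternatingMap.smul_apply,
      ContinuousMultilinearMap.alternatization_apply_apply, smul_eq_mul, Finset.mul_sum]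
    refine Finset.sum_congr rfl fun p _ => Finset.sum_congr rfl fun π _ => ?_
    congr 2
  -- the permutation of the `2m` places that permutes each pair of places
  let τ : (Fin m → Equiv.Perm (Fin 2)) → Equiv.Perm (Fin (m * 2)) := fun κ =>
    finProdFinEquiv.permCongr (Equiv.prodCongrRight κ)
  have hτs : ∀ κ, Equiv.Perm.sign (τ κ) = ∏ i, Equiv.Perm.sign (κ i) := fun κ => by
    simp only [τ, Equiv.Perm.sign_permCongr]
    exact Equiv.Perm.sign_prodCongrRight κ
  have hτ : ∀ κ i t, τ κ (finProdFinEquiv (i, t)) = finProdFinEquiv (i, κ i t) := fun κ i t => by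
    simp [τ, Equiv.permCongr_apply]
  have hpair : ∀ w : Fin (m * 2) → CSpace n, pairProd θ m w
      = ∑ P : Fin m → S, ∑ κ : Fin m → Equiv.Perm (Fin 2), (∏ i, c (P i))
        * (Equiv.Perm.sign (τ κ) • ∏ r, interlace a b P r (w (τ κ r))) := by
    intro w
    have h1 : pairProd θ m w = ∏ i : Fin m, θ fun t => w (finProdFinEquiv (i, t)) := rfl
    simp only [h1, hθ, Finset.prod_univ_sum, Fintype.piFinset_univ]
    refine Finset.sum_congr rfl fun P _ => Finset.sum_congr rfl fun κ _ => ?_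
    rw [Finset.prod_mul_distrib, hτs]
    congr 1
    rw [← finProdFinEquiv.prod_comp, Fintype.prod_prod_type]
    simp only [Units.smul_def, zsmul_eq_mul, Units.coe_prod, Int.cast_prod,
      Finset.prod_mul_distrib, hτ, interlace, Equiv.symm_apply_apply]
  have hdet : ∀ (P : Fin m → S) (ρ : Equiv.Perm (Fin (m * 2))),
      ∑ σ : Equiv.Perm (Fin (m * 2)), Equiv.Perm.sign σ • (Equiv.Perm.sign ρ
        • ∏ r, interlace a b P r (u (σ (ρ r)))) = wedgeRows (interlace a b P) u := by
    intro P ρ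
    rw [wedgeRows, ContinuousMultilinearMap.alternatization_apply_apply]
    refine Fintype.sum_equiv (Equiv.mulRight ρ) _ _ fun σ => ?_
    rw [smul_smul, Equiv.coe_mulRight, Equiv.Perm.sign_mul]
    rfl
  have h2 : formPow θ m u = ((1 / 2 : ℝ) ^ m) • ∑ σ : Equiv.Perm (Fin (m * 2)),
      Equiv.Perm.sign σ • pairProd θ m (u ∘ σ) := by
    rw [formPow, ContinuousAlternatingMap.smul_apply,
      ContinuousMultilinearMap.alternatization_apply_apply]
  have h3 : ∑ σ : Equiv.Perm (Fin (m * 2)), Equiv.Perm.sign σ • pairProd θ m (u ∘ σ)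
      = ∑ P : Fin m → S, ∑ κ : Fin m → Equiv.Perm (Fin 2), (∏ i, c (P i))
        * wedgeRows (interlace a b P) u := by
    simp only [hpair, Finset.smul_sum]
    rw [Finset.sum_comm]
    refine Finset.sum_congr rfl fun P _ => ?_
    rw [Finset.sum_comm]
    refine Finset.sum_congr rfl fun κ _ => ?_
    rw [← hdet P (τ κ), Finset.mul_sum]
    refine Finset.sum_congr rfl fun σ _ => ?_
    exact (mul_smul_comm _ _ _).symm
  rw [h2, h3]
  simp only [Finset.sum_const, Finset.card_univ, Fintype.card_pi, Fintype.card_perm,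
    Fintype.card_fin, Finset.prod_const, ContinuousAlternatingMap.sum_apply,
    ContinuousAlternatingMap.smul_apply, smul_eq_mul, ← Finset.smul_sum]
  rw [← Nat.cast_smul_eq_nsmul ℝ, smul_smul]
  have : ((1 / 2 : ℝ) ^ m) * ((Nat.factorial 2 ^ m : ℕ) : ℝ) = 1 := by
    rw [Nat.factorial_two, Nat.cast_pow, ← mul_pow]; norm_num
  rw [this, one_smul]

/-- The exterior derivative of `∑ c_P f_{P,0} ∧ f_{P,1} ∧ ⋯` with constant forms `f`. -/
lemma extDeriv_sum_smul_wedgeRows {S : Type*} [Fintype S] {N : ℕ} {c : S → CSpace n → ℂ}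
    {z : CSpace n} (hc : ∀ P, DifferentiableAt ℝ (c P) z) (f : S → Fin N → CSpace n →L[ℝ] ℂ)
    (v : Fin (N + 1) → CSpace n) :
    extDeriv (fun w => ∑ P, c P w • wedgeRows (f P)) z v
      = ∑ P, (Matrix.of (Fin.cons (fun s => fderiv ℝ (c P) z (v s))
          fun r s => f P r (v s)) : Matrix (Fin (N + 1)) (Fin (N + 1)) ℂ).det := by
  have hF : DifferentiableAt ℝ (fun w => ∑ P, c P w • wedgeRows (f P)) z :=
    DifferentiableAt.fun_sum fun P _ => (hc P).smul_const _
  rw [extDeriv_apply hF]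
  have h1 : ∀ i : Fin (N + 1), fderiv ℝ (fun w => (∑ P, c P w • wedgeRows (f P))
      (i.removeNth v)) z (v i) = ∑ P, fderiv ℝ (c P) z (v i) * wedgeRows (f P) (i.removeNth v) := by
    intro i
    have : (fun w => (∑ P, c P w • wedgeRows (f P)) (i.removeNth v))
        = fun w => ∑ P, c P w * wedgeRows (f P) (i.removeNth v) := by
      funext w
      simp [ContinuousAlternatingMap.sum_apply]
    rw [this, fderiv_fun_sum fun P _ => (hc P).mul_const _, sum_apply]
    refine Finset.sum_congr rfl fun P _ => ?_
    rw [fderiv_mul_const (hc P)]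
    simp [mul_comm]
  simp only [h1, Finset.smul_sum]
  rw [Finset.sum_comm]
  refine Finset.sum_congr rfl fun P _ => ?_
  rw [Matrix.det_succ_row_zero]
  refine Finset.sum_congr rfl fun i _ => ?_
  rw [wedgeRows_apply, mul_assoc, zsmul_eq_mul]
  push_cast
  rfl

end KahlerPower

/-! ### The balanced condition -/

section Balanced

variable {m : ℕ}

/-- The place of the row `r` of `f₀ ∧ a_{P₀} ∧ b_{P₀} ∧ a_{P₁} ∧ ⋯` when the rows of one kind
(`f₀` and the rows of parity `t`) are moved to the front of those of the other kind. -/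
def sortPlace (t : Fin 2) : Fin (m * 2 + 1) → Fin (m + 1) ⊕ Fin m :=
  Fin.cons (Sum.inl 0) fun r => if (finProdFinEquiv.symm r).2 = t
    then Sum.inl (finProdFinEquiv.symm r).1.succ else Sum.inr (finProdFinEquiv.symm r).1

lemma sortPlace_bijective (t : Fin 2) : Function.Bijective (sortPlace (m := m) t) := by
  rw [Fintype.bijective_iff_injective_and_card]
  refine ⟨?_, by simp; ring⟩
  rw [sortPlace, Fin.cons_injective_iff]
  constructor
  · rintro ⟨r, hr⟩
    dsimp only at hr
    by_cases h : (finProdFinEquiv.symm r).2 = t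
    · rw [if_pos h] at hr
      exact Fin.succ_ne_zero _ (Sum.inl_injective hr)
    · rw [if_neg h] at hr
      exact Sum.inr_ne_inl hr
  · intro r r' h
    refine finProdFinEquiv.symm.injective (Prod.ext ?_ ?_) <;>
    by_cases h1 : (finProdFinEquiv.symm r).2 = t <;>
    by_cases h2 : (finProdFinEquiv.symm r').2 = t <;>
    simp only [h1, h2, if_true, if_false, Sum.inl.injEq, Sum.inr.injEq, reduceCtorEq,
      Fin.succ_inj] at h
    · exact h
    · exact h
    · rw [h1, h2]
    · omega

/-- The determinant, with its rows sorted by `sortPlace`. -/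
noncomputable def sortedDet (m : ℕ) (t : Fin 2) :
    (Fin (m * 2 + 1) → ℂ) [⋀^Fin (m + 1) ⊕ Fin m]→ₗ[ℂ] ℂ :=
  Matrix.detRowAlternating.domDomCongr (Equiv.ofBijective _ (sortPlace_bijective t))

lemma sortedDet_apply (t : Fin 2) (x y : Fin (m + 1) → Fin (m * 2 + 1) → ℂ) (k : Fin (m + 1))
    (I J : Fin m → Fin (m + 1)) :
    sortedDet m t (Sum.elim (x ∘ Fin.cons k I) fun a => y (J a))
      = (Matrix.of (Fin.cons (x k) fun r => if (finProdFinEquiv.symm r).2 = t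
          then x (I (finProdFinEquiv.symm r).1) else y (J (finProdFinEquiv.symm r).1)) :
          Matrix (Fin (m * 2 + 1)) (Fin (m * 2 + 1)) ℂ).det := by
  have : ∀ v, sortedDet m t v = (Matrix.of fun r => v (sortPlace t r)).det := fun v => rfl
  rw [this]
  congr 2
  funext r
  refine Fin.cases rfl (fun r => ?_) r
  simp only [sortPlace, Fin.cons_succ]
  by_cases h : (finProdFinEquiv.symm r).2 = t
  · rw [if_pos h, if_pos h]; rfl
  · rw [if_neg h, if_neg h]; rfl

/-- `d(ω^m) = 0` as soon as the cofactor matrix of the coefficients of `ω` is divergence free. -/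
lemma extDeriv_formPow_eq_zero {G : CSpace (m + 1) → Matrix (Fin (m + 1)) (Fin (m + 1)) ℂ}
    {z : CSpace (m + 1)} (hG : ∀ a b, ContDiffAt ℝ ∞ (fun w => G w a b) z)
    (hdet : (G z).det ≠ 0)
    (hdiv : ∀ s, ∑ k, dZ k (fun w => (G w).adjugate s k) z = 0)
    (hdivbar : ∀ k, ∑ s, dZbar s (fun w => (G w).adjugate s k) z = 0) :
    extDeriv (fun w => formPow (Complex.I • ∑ i, ∑ j, G w i j •
      wedgeOne (formDz i) (formDzbar j)) m) z = 0 := by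
  have hform : (fun w => formPow (Complex.I • ∑ i, ∑ j, G w i j •
      wedgeOne (formDz i) (formDzbar j)) m)
      = fun w => ∑ P : Fin m → Fin (m + 1) × Fin (m + 1),
        (Complex.I ^ m * ∏ a, G w (P a).1 (P a).2) •
          wedgeRows (interlace (fun p => formDz p.1) (fun p => formDzbar p.2) P) := by
    funext w
    have h1 : (Complex.I • ∑ i, ∑ j, G w i j • wedgeOne (formDz i) (formDzbar j) :
        CSpace (m + 1) [⋀^Fin 2]→L[ℝ] ℂ) = ∑ p : Fin (m + 1) × Fin (m + 1),
        (Complex.I * G w p.1 p.2) • wedgeOne (formDz p.1) (formDzbar p.2) := by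
      simp only [Fintype.sum_prod_type, Finset.smul_sum, smul_smul]
    rw [h1]
    refine (formPow_sum_wedgeOne (fun p : Fin (m + 1) × Fin (m + 1) => Complex.I * G w p.1 p.2)
      (fun p => formDz p.1) (fun p => formDzbar p.2) m).trans ?_
    simp [Finset.prod_mul_distrib]
  have hprod : ∀ P : Fin m → Fin (m + 1) × Fin (m + 1),
      DifferentiableAt ℝ (fun w => ∏ a, G w (P a).1 (P a).2) z := fun P =>
    differentiableAt_finsetProd _ fun a _ => (hG _ _).differentiableAt_infty
  ext v
  rw [hform, extDeriv_sum_smul_wedgeRows (fun P => (hprod P).const_mul _)]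
  let x : Fin (m + 1) → Fin (m * 2 + 1) → ℂ := fun k s => v s k
  let y : Fin (m + 1) → Fin (m * 2 + 1) → ℂ := fun k s => conj (v s k)
  let rows (P : Fin m → Fin (m + 1) × Fin (m + 1)) (r : Fin (m * 2)) : Fin (m * 2 + 1) → ℂ :=
    fun s => interlace (fun p => formDz p.1) (fun p => formDzbar p.2) P r (v s)
  have hsplit : ∀ P : Fin m → Fin (m + 1) × Fin (m + 1),
      (Matrix.of (Fin.cons (fun s => fderiv ℝ (fun w => Complex.I ^ m * ∏ a, G w (P a).1 (P a).2)
        z (v s)) (rows P)) : Matrix (Fin (m * 2 + 1)) (Fin (m * 2 + 1)) ℂ).det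
      = ∑ k, Complex.I ^ m * (
          dZ k (fun w => ∏ a, G w (P a).1 (P a).2) z * Matrix.det (Fin.cons (x k) (rows P))
          + dZbar k (fun w => ∏ a, G w (P a).1 (P a).2) z
            * Matrix.det (Fin.cons (y k) (rows P))) := by
    intro P
    let L : (Fin (m * 2 + 1) → ℂ) →ₗ[ℂ] ℂ :=
      { toFun := fun r => Matrix.detRowAlternating (Fin.cons r (rows P))
        map_add' := fun r r' => MultilinearMap.cons_add
          (Matrix.detRowAlternating (R := ℂ)).toMultilinearMap (rows P) r r'
        map_smul' := fun a r => MultilinearMap.cons_smul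
          (Matrix.detRowAlternating (R := ℂ)).toMultilinearMap (rows P) a r }
    have hrow : (fun s => fderiv ℝ (fun w => Complex.I ^ m * ∏ a, G w (P a).1 (P a).2) z (v s))
        = ∑ k, (Complex.I ^ m) • (dZ k (fun w => ∏ a, G w (P a).1 (P a).2) z • x k
            + dZbar k (fun w => ∏ a, G w (P a).1 (P a).2) z • y k) := by
      funext s
      rw [fderiv_const_mul (hprod P), smul_apply, fderiv_apply_eq_sum, Finset.smul_sum,
        Finset.sum_apply]
      rfl
    change L _ = _
    rw [hrow, map_sum]
    simp only [map_smul, map_add, smul_eq_mul]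
    rfl
  refine (Finset.sum_congr rfl fun P _ => hsplit P).trans ?_
  simp only [← Finset.mul_sum, Finset.sum_add_distrib]
  have hx : ∑ P : Fin m → Fin (m + 1) × Fin (m + 1), ∑ k,
      dZ k (fun w => ∏ a, G w (P a).1 (P a).2) z * Matrix.det (Fin.cons (x k) (rows P)) = 0 := by
    rw [Finset.sum_comm]
    have h := sum_wirt_prod_eq_zero (sortedDet m 0) x y hG hdet (-Complex.I)
      (by simpa only [dZ_eq_wirt] using hdiv)
    refine Eq.trans ?_ h
    refine Finset.sum_congr rfl fun k _ => Finset.sum_congr rfl fun P _ => ?_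
    rw [dZ_eq_wirt, sortedDet_apply 0 x y k (fun a => (P a).1) fun a => (P a).2]
    congr 3
    funext r s
    simp only [rows, interlace]
    split_ifs <;> rfl
  have hy : ∑ P : Fin m → Fin (m + 1) × Fin (m + 1), ∑ k,
      dZbar k (fun w => ∏ a, G w (P a).1 (P a).2) z * Matrix.det (Fin.cons (y k) (rows P)) = 0 := by
    rw [Finset.sum_comm]
    have h := sum_wirt_prod_eq_zero (sortedDet m 1) y x (G := fun w => (G w)ᵀ)
      (fun a b => hG b a) (by rwa [Matrix.det_transpose]) Complex.I
      (by simpa only [dZbar_eq_wirt, ← Matrix.adjugate_transpose, Matrix.transpose_apply]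
        using hdivbar)
    refine Eq.trans ?_ h
    refine Finset.sum_congr rfl fun k _ => ?_
    refine Fintype.sum_equiv (Equiv.arrowCongr (Equiv.refl _) (Equiv.prodComm _ _)) _ _
      fun P => ?_
    rw [dZbar_eq_wirt, sortedDet_apply 1 y x k]
    congr 3
    funext r s
    simp only [rows, interlace]
    by_cases h : (finProdFinEquiv.symm r).2 = 0
    · rw [if_pos h, if_neg (by omega)]; rfl
    · rw [if_neg h, if_pos (by omega)]; rfl
  rw [hx, hy, add_zero, mul_zero]
  rfl

end Balanced

/-- A metric with vanishing torsion `(1,0)`-form is balanced. -/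
lemma HermitianMetric.isBalanced_of_torsionTrace_eq_zero {n : ℕ} {M : Type*} [TopologicalSpace M]
    [ChartedSpace (CSpace n) M] [IsManifold 𝓘(ℂ, CSpace n) ω M] (g : HermitianMetric n M)
    (htor : ∀ e ∈ IsManifold.maximalAtlas 𝓘(ℂ, CSpace n) ω M, ∀ z ∈ e.target, ∀ i,
      torsionTrace (g.coeffMatrix e) i z = 0) : g.IsBalanced := by
  intro e he z hz
  rcases n with _ | m
  · -- in dimension zero, alternating maps of positive degree vanish
    ext v
    exact ContinuousAlternatingMap.map_coord_zero _ (0 : Fin (0 * 2 + 1)) (Subsingleton.elim _ _)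
  · have hG := fun a b => g.contDiffAt_coeffMatrix he hz a b
    have hdet := (g.posDef_coeffMatrix he hz).det_pos.ne'
    have hherm : ∀ᶠ w in nhds z, (g.coeffMatrix e w).IsHermitian :=
      Filter.Eventually.of_forall fun w => g.isHermitian_coeffMatrix e w
    refine extDeriv_formPow_eq_zero (G := g.coeffMatrix e) hG hdet (fun s => ?_) fun k => ?_
    · rw [sum_dZ_adjugate hG hdet]
      simp [htor e he z hz]
    · rw [sum_dZbar_adjugate hG hdet hherm]
      simp [htor e he z hz]

theorem theorem1p3 {n : ℕ} {M : Type*} [TopologicalSpace M] [T2Space M] [CompactSpace M]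
    [ChartedSpace (CSpace n) M] [IsManifold 𝓘(ℂ, CSpace n) ω M]
    (g : HermitianMetric n M) (k : RicciKind) (α β : ℝ) (hβ : β ≠ 0)
    (hC : ∀ (p : M) (X : TangentSpace 𝓘(ℂ, CSpace n) p), X ≠ 0 → g.mixedCurv k α β p X = 0)
    (hαβ : α * (n + 1) + 2 * β = 0) :
    (∀ p : M, g.chernScalar p = g.alteredChernScalar p) ∧
      (∀ p : M, g.torsionForm p = 0) ∧ g.IsBalanced := by
  have huv : ∀ p : M, g.chernScalar p = g.alteredChernScalar p := fun p =>
    g.chernScalar_eq_alteredChernScalar k α β hβ hαβ p (hC p)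
  have htor : ∀ e ∈ IsManifold.maximalAtlas 𝓘(ℂ, CSpace n) ω M, ∀ z ∈ e.target, ∀ i,
      torsionTrace (g.coeffMatrix e) i z = 0 := fun e he z hz =>
    g.torsionTrace_eq_zero (fun e he z hz => g.traceH_dZbar_torsionTrace_eq_zero huv he hz) he hz
  refine ⟨huv, fun p => ?_, g.isBalanced_of_torsionTrace_eq_zero htor⟩
  refine Finset.sum_eq_zero fun i _ => ?_
  rw [g.sum_torsion_eq, htor _ (IsManifold.chart_mem_maximalAtlas p) _
    (mem_chart_target (CSpace n) p)]
  exact zero_smul ℂ (coordForm (chartAt (CSpace n) p) p i)
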